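/- Let $\mathbb S=\{x\in\mathbb H:\ \mathrm{Re}\,x=0,\ |x|=1\}$, let $i\in\mathbb S$ and $\alpha>-1$, and put $\mathbb C_i=\{u+iv: u,v\in\mathbb R\}$, $\mathbb D=\{x\in\mathbb H:|x|<1\}$, $\mathbb D_i=\mathbb D\cap\mathbb C_i$ and $dA_{\alpha,i}(z)=\frac{\alpha+1}{\pi}(1-|z|^2)^\alpha\,dm_i(z)$, where $m_i$ is Lebesgue measure on $\mathbb C_i$. A function $f:\mathbb D\to\mathbb H$ is left slice hyperholomorphic if it is real differentiable and $f(u+Iv)=a(u,v)+I\,b(u,v)$ for all $I\in\mathbb S$ and $u+Iv\in\mathbb D$, with $\mathbb H$-valued $a,b$ such that $a(u,-v)=a(u,v)$, $b(u,-v)=-b(u,v)$, $\partial_u a=\partial_v b$ and $\partial_u b=-\partial_v a$. Let $\mathcal A=\mathcal A^2_{\alpha,i}(\mathbb D)$ be the right $\mathbb H$-vector space of the left slice hyperholomorphic functions $f$ on $\mathbb D$ with $\|f\|^2=\int_{\mathbb D_i}|f|^2\,dA_{\alpha,i}<\infty$, with the scalar product $\langle f,g\rangle=\int_{\mathbb D_i}\overline{f(z)}g(z)\,dA_{\alpha,i}(z)$.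 For $f\in\mathcal A$ let $Jf\in\mathcal A$ be the unique left slice hyperholomorphic function on $\mathbb D$ that equals $z\mapsto i\,f(z)$ on $\mathbb D_i$, and let $\mathcal B_J(\mathcal A)$ be the set of all bounded right $\mathbb H$-linear operators $T$ on $\mathcal A$ with $TJ=JT$, with the operator norm $\|T\|=\sup_{\|f\|=1}\|Tf\|$. For $w\in\mathbb D_i$ let $K_w\in\mathcal A$ be the unique left slice hyperholomorphic function on $\mathbb D$ with $K_w(z)=(1-z\overline w)^{-(2+\alpha)}$ (principal branch in $\mathbb C_i$) for $z\in\mathbb D_i$, let $k_w=K_w/\|K_w\|$, and for $T\in\mathcal B_J(\mathcal A)$ let $\widetilde T(w)=\langle k_w,Tk_w\rangle$ be its Berezin transform. For $z,w\in\mathbb D_i$ let $\rho(z,w)=\frac{|z-w|}{|1-z\overline w|}$ be the pseudo-hyperbolic metric. Theorem. The functions $K_w$ are the reproducing kernels: $\langle K_w,f\rangle=f(w)$ for all $w\in\mathbb D_i$ and $f\in\mathcal A$. For every $T\in\mathcal B_J(\mathcal A)$, $$|\widetilde T(z)-\widetilde T(w)|\le 2\sqrt{2+\alpha}\,\|T\|\,\rho(z,w)\qquad\text{for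 all } z,w\in\mathbb D_i.$$ The Lipschitz constant $2\sqrt{2+\alpha}$ is sharp: if $C\in\mathbb R$ is such that $|\widetilde T(z)-\widetilde T(w)|\le C\,\|T\|\,\rho(z,w)$ for all $T\in\mathcal B_J(\mathcal A)$ and all $z,w\in\mathbb D_i$, then $C\ge 2\sqrt{2+\alpha}$. -/

import Mathlib

open scoped Quaternion

noncomputable section

namespace SliceBergman

/-- The sphere `𝕊` of imaginary units of `ℍ`. -/
abbrev ImaginaryUnit : Type := {x : ℍ // x.re = 0 ∧ ‖x‖ = 1}

theorem ImaginaryUnit.mul_self (i : ImaginaryUnit) : (i : ℍ) * (i : ℍ) = -1 := by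
  obtain ⟨x, h0, h1⟩ := i
  have h : Quaternion.normSq x = 1 := by
    rw [Quaternion.normSq_eq_norm_mul_self, h1, one_mul]
  rw [Quaternion.normSq_def'] at h
  ext
  · simp [h0]; nlinarith
  · simp [h0]; ring
  · simp [h0]; ring
  · simp [h0]; ring

/-- The embedding `u + 𝐢 v ↦ u + i v` of `ℂ` onto the plane `ℂ_i ⊆ ℍ`. -/
def plane (i : ImaginaryUnit) : ℂ →ₐ[ℝ] ℍ := Complex.liftAux (i : ℍ) i.mul_self

theorem plane_apply (i : ImaginaryUnit) (ζ : ℂ) :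
    plane i ζ = (ζ.re : ℍ) + ζ.im • (i : ℍ) := rfl

/-- The open unit ball `𝔻` of `ℍ`. -/
abbrev ball : Set ℍ := Metric.ball (0 : ℍ) 1

/-- `𝔻_i = 𝔻 ∩ ℂ_i`. -/
def sliceDisc (i : ImaginaryUnit) : Set ℍ := ball ∩ Set.range (plane i)

/-- The coordinate in `ℂ` of the orthogonal projection of `x` to `ℂ_i`; for `x ∈ ℂ_i` this
is the point `ζ` with `plane i ζ = x`. -/
def coord (i : ImaginaryUnit) (x : ℍ) : ℂ := ⟨x.re, inner ℝ (i : ℍ) x⟩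

/-- `f` is left slice hyperholomorphic on `U` (meant for axially symmetric open `U`): it is real
differentiable and `f (u + I v) = a (u, v) + I b (u, v)` for all imaginary units `I`, where `a` is
even and `b` is odd in `v`, and `∂a/∂u = ∂b/∂v` (`= p`), `∂b/∂u = -∂a/∂v` (`= q`). -/
def IsLeftSliceHyperholomorphicOn (f : ℍ → ℍ) (U : Set ℍ) : Prop :=
  DifferentiableOn ℝ f U ∧
    ∃ a b : ℝ → ℝ → ℍ, ∀ (I : ImaginaryUnit) (u v : ℝ), plane I ⟨u, v⟩ ∈ U →
      f (plane I ⟨u, v⟩) = a u v + (I : ℍ) * b u v ∧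
      a u (-v) = a u v ∧ b u (-v) = -b u v ∧
      ∃ p q : ℍ,
        HasDerivAt (fun s => a s v) p u ∧ HasDerivAt (fun t => b u t) p v ∧
        HasDerivAt (fun s => b s v) q u ∧ HasDerivAt (fun t => a u t) (-q) v

/-- The weighted area measure `(α + 1) / π * (1 - |z|²) ^ α dm(z)` on the unit disc. -/
def areaMeasure (α : ℝ) : MeasureTheory.Measure ℂ :=
  (MeasureTheory.volume.restrict (Metric.ball (0 : ℂ) 1)).withDensity
    fun z => ENNReal.ofReal ((α + 1) / Real.pi * (1 - ‖z‖ ^ 2) ^ α)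

/-- Extension by zero of a function on `𝔻`. -/
def extendZero (f : ball → ℍ) (x : ℍ) : ℍ :=
  open scoped Classical in if h : x ∈ ball then f ⟨x, h⟩ else 0

theorem extendZero_of_mem (f : ball → ℍ) {x : ℍ} (h : x ∈ ball) : extendZero f x = f ⟨x, h⟩ := by
  simp only [extendZero]
  exact dif_pos h

theorem extendZero_add (f g : ball → ℍ) : extendZero (f + g) = extendZero f + extendZero g := by
  funext x
  by_cases h : x ∈ ball <;> simp [extendZero, h]

theorem extendZero_smul (c : ℍᵐᵒᵖ) (f : ball → ℍ) :
    extendZero (c • f) = fun x => extendZero f x * c.unop := by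
  funext x
  by_cases h : x ∈ ball <;> simp [extendZero, h]

/-- The weighted slice Bergman space `𝒜²_{α,i}(𝔻)`, as a right vector space over `ℍ`. -/
def BergmanSpace (i : ImaginaryUnit) (α : ℝ) : Submodule ℍᵐᵒᵖ (ball → ℍ) where
  carrier := {f | IsLeftSliceHyperholomorphicOn (extendZero f) ball ∧
    MeasureTheory.MemLp (fun z : ℂ => extendZero f (plane i z)) 2 (areaMeasure α)}
  zero_mem' := by
    have h0 : extendZero (0 : ball → ℍ) = fun _ => 0 := by
      funext x
      by_cases h : x ∈ ball <;> simp [extendZero, h]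
    refine ⟨?_, ?_⟩
    · rw [h0]
      refine ⟨differentiableOn_const _, fun _ _ => 0, fun _ _ => 0, fun I u v _ => ?_⟩
      refine ⟨by simp, rfl, by simp, 0, 0, ?_⟩
      simp only [neg_zero]
      exact ⟨hasDerivAt_const _ _, hasDerivAt_const _ _, hasDerivAt_const _ _,
        hasDerivAt_const _ _⟩
    · simp [h0]
  add_mem' := by
    rintro f g ⟨⟨hfd, a, b, hf⟩, hfL⟩ ⟨⟨hgd, a', b', hg⟩, hgL⟩
    refine ⟨?_, ?_⟩
    · rw [extendZero_add]
      refine ⟨hfd.add hgd, fun u v => a u v + a' u v, fun u v => b u v + b' u v,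
        fun I u v h => ?_⟩
      obtain ⟨h1, h2, h3, p, q, h4, h5, h6, h7⟩ := hf I u v h
      obtain ⟨k1, k2, k3, p', q', k4, k5, k6, k7⟩ := hg I u v h
      refine ⟨?_, ?_, ?_, p + p', q + q', h4.add k4, h5.add k5, h6.add k6, ?_⟩
      · rw [Pi.add_apply, h1, k1, mul_add, add_add_add_comm]
      · simp only [h2, k2]
      · simp only [h3, k3]; abel
      · rw [neg_add]; exact h7.add k7
    · rw [extendZero_add]
      exact hfL.add hgL
  smul_mem' := by
    rintro c f ⟨⟨hfd, a, b, hf⟩, hfL⟩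
    refine ⟨?_, ?_⟩
    · rw [extendZero_smul]
      refine ⟨hfd.mul_const _, fun u v => a u v * c.unop, fun u v => b u v * c.unop,
        fun I u v h => ?_⟩
      obtain ⟨h1, h2, h3, p, q, h4, h5, h6, h7⟩ := hf I u v h
      refine ⟨?_, ?_, ?_, p * c.unop, q * c.unop, h4.mul_const _, h5.mul_const _,
        h6.mul_const _, ?_⟩
      · change extendZero f _ * _ = _
        rw [h1, add_mul, mul_assoc]
      · simp only [h2]
      · simp only [h3, neg_mul]
      · rw [← neg_mul]; exact h7.mul_const _
    · rw [extendZero_smul]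
      exact hfL.mul_const _

/-- The scalar product `∫_{𝔻_i} conj (f z) g z dA_{α,i}(z)`. -/
def scalarProduct {i : ImaginaryUnit} {α : ℝ} (f g : BergmanSpace i α) : ℍ :=
  ∫ z : ℂ, star (extendZero f (plane i z)) * extendZero g (plane i z) ∂(areaMeasure α)

/-- The norm `(∫_{𝔻_i} |f z|² dA_{α,i}(z)) ^ (1/2)`. -/
def bergmanNorm {i : ImaginaryUnit} {α : ℝ} (f : BergmanSpace i α) : ℝ :=
  Real.sqrt (∫ z : ℂ, ‖extendZero f (plane i z)‖ ^ 2 ∂(areaMeasure α))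

/-- The slice extension
`ext g (x₀ + i_x x₁) = ½ (1 - i_x i) g (x₀ + i x₁) + ½ (1 + i_x i) g (x₀ - i x₁)` of a function `g`
on `ℂ ≅ ℂ_i`, where `x₁ = |im x|` and `i_x = im x / |im x|` (for real `x` the two terms containing
`i_x` cancel, so that its value is irrelevant). -/
def sliceExt (i : ImaginaryUnit) (g : ℂ → ℍ) (x : ℍ) : ℍ :=
  (2⁻¹ : ℝ) • ((1 - (‖x.im‖⁻¹ • x.im) * (i : ℍ)) * g ⟨x.re, ‖x.im‖⟩) +
    (2⁻¹ : ℝ) • ((1 + (‖x.im‖⁻¹ • x.im) * (i : ℍ)) * g ⟨x.re, -‖x.im‖⟩)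

theorem sliceExt_plane (i I : ImaginaryUnit) (g : ℂ → ℍ) (u v : ℝ) :
    sliceExt i g (plane I ⟨u, v⟩) =
      (2⁻¹ : ℝ) • (g ⟨u, v⟩ + g ⟨u, -v⟩) +
        (I : ℍ) * ((2⁻¹ : ℝ) • (-((i : ℍ) * (g ⟨u, v⟩ - g ⟨u, -v⟩)))) := by
  have hre : (plane I ⟨u, v⟩).re = u := by simp [plane_apply, I.2.1]
  have him : (plane I ⟨u, v⟩).im = v • (I : ℍ) := by
    ext <;> simp [plane_apply, I.2.1]
  have hn : ‖(plane I ⟨u, v⟩).im‖ = |v| := by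
    rw [him, norm_smul, I.2.2, mul_one, Real.norm_eq_abs]
  rw [sliceExt, hre, hn, him]
  rcases lt_trichotomy v 0 with h | h | h
  · have h1 : (|v|⁻¹ • v • (I : ℍ)) = -(I : ℍ) := by
      rw [smul_smul, abs_of_neg h, inv_neg, neg_mul, inv_mul_cancel₀ h.ne, neg_one_smul]
    rw [h1, abs_of_neg h, neg_neg]
    simp only [mul_smul_comm, ← smul_add]
    congr 1
    noncomm_ring
  · subst h
    simp only [abs_zero, zero_smul, smul_zero, zero_mul, sub_zero, add_zero, neg_zero, one_mul,
      sub_self, mul_zero, smul_add]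
  · have h1 : (|v|⁻¹ • v • (I : ℍ)) = (I : ℍ) := by
      rw [smul_smul, abs_of_pos h, inv_mul_cancel₀ h.ne', one_smul]
    rw [h1, abs_of_pos h]
    simp only [mul_smul_comm, ← smul_add]
    congr 1
    noncomm_ring

theorem sliceExt_plane_self (i : ImaginaryUnit) (g : ℂ → ℍ) (ζ : ℂ) :
    sliceExt i g (plane i ζ) = g ζ := by
  obtain ⟨u, v⟩ := ζ
  rw [sliceExt_plane, mul_smul_comm, mul_neg, ← mul_assoc, i.mul_self, neg_one_mul, neg_neg,
    ← smul_add, add_add_sub_cancel, ← two_smul ℝ, smul_smul]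
  norm_num

theorem norm_plane (i : ImaginaryUnit) (ζ : ℂ) : ‖plane i ζ‖ = ‖ζ‖ := by
  have h : Quaternion.normSq (i : ℍ) = 1 := by
    rw [Quaternion.normSq_eq_norm_mul_self, i.2.2, one_mul]
  rw [Quaternion.normSq_def', i.2.1] at h
  have h2 : ‖plane i ζ‖ ^ 2 = ‖ζ‖ ^ 2 := by
    rw [sq, ← Quaternion.normSq_eq_norm_mul_self, Complex.sq_norm, Complex.normSq_apply,
      Quaternion.normSq_def']
    simp [plane_apply, i.2.1]
    linear_combination (ζ.im ^ 2) * h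
  exact (sq_eq_sq₀ (norm_nonneg _) (norm_nonneg _)).1 h2

theorem plane_mem_ball (i : ImaginaryUnit) (ζ : ℂ) : plane i ζ ∈ ball ↔ ‖ζ‖ < 1 := by
  rw [mem_ball_zero_iff, norm_plane]

/-- The real linear map `h ↦ h p` on `ℂ ≅ ℂ_i`. -/
def mulRight (i : ImaginaryUnit) (p : ℍ) : ℂ →L[ℝ] ℍ :=
  LinearMap.toContinuousLinearMap ((LinearMap.mulRight ℝ p).comp (plane i).toLinearMap)

theorem mulRight_apply (i : ImaginaryUnit) (p : ℍ) (h : ℂ) :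
    mulRight i p h = plane i h * p := rfl

/-- `g` is holomorphic on the unit disc with respect to multiplication by `i` from the left. -/
def IsHolomorphic (i : ImaginaryUnit) (g : ℂ → ℍ) : Prop :=
  ∀ ζ : ℂ, ‖ζ‖ < 1 → ∃ p : ℍ, HasFDerivAt g (mulRight i p) ζ

theorem norm_mk_neg (u v : ℝ) : ‖(⟨u, -v⟩ : ℂ)‖ = ‖(⟨u, v⟩ : ℂ)‖ :=
  Complex.norm_conj ⟨u, v⟩

theorem hasDerivAt_mk_left (u v : ℝ) : HasDerivAt (fun s : ℝ => (⟨s, v⟩ : ℂ)) 1 u := by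
  have h : (fun s : ℝ => (⟨s, v⟩ : ℂ)) = fun s : ℝ => (s : ℂ) + v * Complex.I := by
    funext s; exact Complex.mk_eq_add_mul_I s v
  rw [h]
  exact (Complex.ofRealCLM.hasDerivAt).add_const _

theorem hasDerivAt_mk_right (u v : ℝ) :
    HasDerivAt (fun t : ℝ => (⟨u, t⟩ : ℂ)) Complex.I v := by
  have h : (fun t : ℝ => (⟨u, t⟩ : ℂ)) = fun t : ℝ => (u : ℂ) + t * Complex.I := by
    funext s; exact Complex.mk_eq_add_mul_I u s
  rw [h]
  simpa using ((Complex.ofRealCLM.hasDerivAt (x := v)).mul_const Complex.I).const_add (u : ℂ)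

theorem differentiableAt_mk {x : ℍ} {r : ℍ → ℝ} (hr : DifferentiableAt ℝ r x) :
    DifferentiableAt ℝ (fun y : ℍ => (⟨y.re, r y⟩ : ℂ)) x := by
  have h : (fun y : ℍ => (⟨y.re, r y⟩ : ℂ)) =
      fun y : ℍ => ((inner ℝ y 1 : ℝ) : ℂ) + (r y : ℂ) * Complex.I := by
    funext y
    rw [Quaternion.inner_def, star_one, mul_one]
    exact Complex.mk_eq_add_mul_I _ _
  rw [h]
  have h1 : DifferentiableAt ℝ (fun y : ℍ => (inner ℝ y 1 : ℝ)) x :=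
    differentiableAt_id.inner ℝ (differentiableAt_const _)
  exact ((Complex.ofRealCLM.differentiableAt).comp x h1).add
    (((Complex.ofRealCLM.differentiableAt).comp x hr).mul_const _)

theorem differentiableAt_im (x : ℍ) : DifferentiableAt ℝ (fun y : ℍ => y.im) x := by
  have h : (fun y : ℍ => y.im) = fun y : ℍ => y - (inner ℝ y 1 : ℝ) • (1 : ℍ) := by
    funext y
    rw [Quaternion.inner_def, star_one, mul_one]
    ext <;> simp
  rw [h]
  exact differentiableAt_id.sub
    ((differentiableAt_id.inner ℝ (differentiableAt_const _)).smul_const _)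

theorem norm_mk_im (x : ℍ) : ‖(⟨x.re, ‖x.im‖⟩ : ℂ)‖ = ‖x‖ := by
  have h2 : ‖(⟨x.re, ‖x.im‖⟩ : ℂ)‖ ^ 2 = ‖x‖ ^ 2 := by
    rw [Complex.sq_norm, Complex.normSq_apply, ← Quaternion.normSq_eq_norm_mul_self, sq,
      ← Quaternion.normSq_eq_norm_mul_self, Quaternion.normSq_def', Quaternion.normSq_def']
    simp
    ring
  exact (sq_eq_sq₀ (norm_nonneg _) (norm_nonneg _)).1 h2

theorem norm_imUnit_le (x : ℍ) : ‖‖x.im‖⁻¹ • x.im‖ ≤ 1 := by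
  rw [norm_smul, norm_inv, norm_norm]
  exact inv_mul_le_one

theorem sliceExt_differentiableAt_of_ne (i : ImaginaryUnit) (g : ℂ → ℍ) (hg : IsHolomorphic i g)
    (x : ℍ) (hx : ‖x‖ < 1) (h0 : x.im ≠ 0) : DifferentiableAt ℝ (sliceExt i g) x := by
  have hn : DifferentiableAt ℝ (fun y : ℍ => ‖y.im‖) x := (differentiableAt_im x).norm ℝ h0
  have hu : DifferentiableAt ℝ (fun y : ℍ => ‖y.im‖⁻¹ • y.im) x :=
    (hn.inv (norm_ne_zero_iff.2 h0)).smul (differentiableAt_im x)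
  obtain ⟨p, hp⟩ := hg ⟨x.re, ‖x.im‖⟩ (by rwa [norm_mk_im])
  obtain ⟨q, hq⟩ := hg ⟨x.re, -‖x.im‖⟩ (by rwa [norm_mk_neg, norm_mk_im])
  have h1 : DifferentiableAt ℝ (fun y : ℍ => g ⟨y.re, ‖y.im‖⟩) x :=
    DifferentiableAt.comp (g := g) x hp.differentiableAt (differentiableAt_mk hn)
  have h2 : DifferentiableAt ℝ (fun y : ℍ => g ⟨y.re, -‖y.im‖⟩) x :=
    DifferentiableAt.comp (g := g) x hq.differentiableAt (differentiableAt_mk hn.neg)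
  unfold sliceExt
  exact ((((hu.mul_const _).const_sub 1).mul h1).const_smul (2⁻¹ : ℝ)).add
    ((((hu.mul_const _).const_add 1).mul h2).const_smul (2⁻¹ : ℝ))

theorem sliceExt_differentiableAt_of_eq (i : ImaginaryUnit) (g : ℂ → ℍ) (hg : IsHolomorphic i g)
    (x : ℍ) (hx : ‖x‖ < 1) (h0 : x.im = 0) : DifferentiableAt ℝ (sliceExt i g) x := by
  have hζ : (⟨x.re, 0⟩ : ℂ) = ⟨x.re, ‖x.im‖⟩ := by rw [h0, norm_zero]
  obtain ⟨p, hp⟩ := hg ⟨x.re, 0⟩ (by rw [hζ]; rwa [norm_mk_im])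
  have hx0 : sliceExt i g x = g ⟨x.re, 0⟩ := by
    rw [sliceExt, h0, norm_zero, neg_zero, smul_zero, zero_mul, sub_zero, add_zero, one_mul,
      ← two_smul ℝ, smul_smul]
    norm_num
  have key : ∀ σ : ℝ, |σ| = 1 →
      (fun y : ℍ => g ⟨y.re, σ * ‖y.im‖⟩ - g ⟨x.re, 0⟩ -
        mulRight i p ((⟨y.re, σ * ‖y.im‖⟩ : ℂ) - ⟨x.re, 0⟩)) =o[nhds x] fun y => y - x := by
    intro σ hσ
    have hnorm : ∀ y : ℍ, ‖(⟨y.re, σ * ‖y.im‖⟩ : ℂ) - ⟨x.re, 0⟩‖ = ‖y - x‖ := by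
      intro y
      have h2 : ‖(⟨y.re, σ * ‖y.im‖⟩ : ℂ) - ⟨x.re, 0⟩‖ ^ 2 = ‖y - x‖ ^ 2 := by
        have e1 : (y - x).im = y.im := by
          rw [Quaternion.im_sub, h0, sub_zero]
        rw [← norm_mk_im (y - x), e1, Complex.sq_norm, Complex.sq_norm, Complex.normSq_apply,
          Complex.normSq_apply]
        have e2 : σ * σ = 1 := by rw [← abs_mul_abs_self, hσ, one_mul]
        simp
        linear_combination (‖y.im‖ ^ 2) * e2
      exact (sq_eq_sq₀ (norm_nonneg _) (norm_nonneg _)).1 h2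
    have ht : Filter.Tendsto (fun y : ℍ => (⟨y.re, σ * ‖y.im‖⟩ : ℂ)) (nhds x)
        (nhds ⟨x.re, 0⟩) := by
      rw [tendsto_iff_norm_sub_tendsto_zero]
      simp only [hnorm]
      exact tendsto_iff_norm_sub_tendsto_zero.1 Filter.tendsto_id
    have h3 := hp.isLittleO.comp_tendsto ht
    exact h3.trans_isBigO (Asymptotics.isBigO_of_le _ fun y => (hnorm y).le)
  have k1 := key 1 abs_one
  have k2 := key (-1) (by simp)
  have hb : ∀ s : ℍ, ‖s‖ ≤ 1 → ‖(2⁻¹ : ℝ) • (1 - s)‖ ≤ 1 := by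
    intro s hs
    rw [norm_smul, norm_inv, Real.norm_ofNat]
    have := norm_sub_le (1 : ℍ) s
    rw [norm_one] at this
    linarith
  have hι : ∀ y : ℍ, ‖(‖y.im‖⁻¹ • y.im) * (i : ℍ)‖ ≤ 1 := fun y => by
    rw [norm_mul, i.2.2, mul_one]; exact norm_imUnit_le y
  have b1 : (fun y : ℍ => (2⁻¹ : ℝ) • (1 - (‖y.im‖⁻¹ • y.im) * (i : ℍ))) =O[nhds x]
      fun _ => (1 : ℝ) :=
    Asymptotics.isBigO_of_le _ fun y => by
      rw [norm_one]; exact hb _ (hι y)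
  have b2 : (fun y : ℍ => (2⁻¹ : ℝ) • (1 - -((‖y.im‖⁻¹ • y.im) * (i : ℍ)))) =O[nhds x]
      fun _ => (1 : ℝ) :=
    Asymptotics.isBigO_of_le _ fun y => by
      rw [norm_one]; exact hb _ (by rw [norm_neg]; exact hι y)
  have t1 := b1.mul_isLittleO k1.norm_right
  have t2 := b2.mul_isLittleO k2.norm_right
  have t := t1.add t2
  simp only [one_mul] at t
  have hd : HasFDerivAt (sliceExt i g)
      (LinearMap.toContinuousLinearMap (LinearMap.mulRight ℝ p : ℍ →ₗ[ℝ] ℍ)) x := by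
    refine HasFDerivAt.of_isLittleO (t.of_norm_right.congr_left fun y => ?_)
    have hs : ‖y.im‖ • (‖y.im‖⁻¹ • y.im) = y.im := by
      rcases eq_or_ne y.im 0 with h | h
      · rw [h, smul_zero, smul_zero]
      · rw [smul_smul, mul_inv_cancel₀ (norm_ne_zero_iff.2 h), one_smul]
    have hyx : y - x = ((y.re - x.re : ℝ) : ℍ) + ‖y.im‖ • (‖y.im‖⁻¹ • y.im) := by
      rw [hs]
      have hxx : x = (x.re : ℍ) := by
        conv_lhs => rw [← Quaternion.re_add_im x, h0, add_zero]
      conv_lhs => rw [hxx, ← Quaternion.re_add_im y]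
      rw [Quaternion.coe_sub]
      abel
    have hp1 : ∀ σ : ℝ, plane i ((⟨y.re, σ⟩ : ℂ) - ⟨x.re, 0⟩) =
        ((y.re - x.re : ℝ) : ℍ) + σ • (i : ℍ) := by
      intro σ
      rw [plane_apply, Complex.sub_re, Complex.sub_im, sub_zero]
    have hr : (LinearMap.toContinuousLinearMap (LinearMap.mulRight ℝ p : ℍ →ₗ[ℝ] ℍ)) (y - x) =
      (y - x) * p := rfl
    have hii := i.mul_self
    rw [hr, hyx, mulRight_apply, mulRight_apply, hp1, hp1, hx0, sliceExt]
    simp only [neg_one_mul, neg_smul]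
    generalize ‖y.im‖⁻¹ • y.im = s
    generalize ((y.re - x.re : ℝ) : ℍ) = h
    generalize ‖y.im‖ = n
    generalize g ⟨y.re, n⟩ = A
    generalize g ⟨y.re, -n⟩ = B
    have e : s * (i : ℍ) * (n • (i : ℍ) * p) = -(n • s * p) := by
      rw [smul_mul_assoc, mul_smul_comm, mul_assoc, ← mul_assoc (i : ℍ), hii, neg_one_mul, mul_neg,
        smul_neg, smul_mul_assoc]
    simp only [smul_mul_assoc (2⁻¹ : ℝ), mul_sub, sub_mul, add_mul, mul_add, one_mul, neg_mul,
      mul_neg, e]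
    module
  exact hd.differentiableAt

/-- The slice extension of a holomorphic function is left slice hyperholomorphic. -/
theorem sliceExt_isLeftSliceHyperholomorphicOn (i : ImaginaryUnit) (g : ℂ → ℍ)
    (hg : IsHolomorphic i g) : IsLeftSliceHyperholomorphicOn (sliceExt i g) ball := by
  refine ⟨fun x hx => ?_, fun u v => (2⁻¹ : ℝ) • (g ⟨u, v⟩ + g ⟨u, -v⟩),
    fun u v => (2⁻¹ : ℝ) • (-((i : ℍ) * (g ⟨u, v⟩ - g ⟨u, -v⟩))), fun I u v h => ?_⟩
  · rw [mem_ball_zero_iff] at hx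
    by_cases h0 : x.im = 0
    · exact (sliceExt_differentiableAt_of_eq i g hg x hx h0).differentiableWithinAt
    · exact (sliceExt_differentiableAt_of_ne i g hg x hx h0).differentiableWithinAt
  · rw [plane_mem_ball] at h
    obtain ⟨p, hp⟩ := hg ⟨u, v⟩ h
    obtain ⟨q, hq⟩ := hg ⟨u, -v⟩ (by rwa [norm_mk_neg])
    have e1 : mulRight i p 1 = p := by rw [mulRight_apply, map_one, one_mul]
    have e2 : mulRight i q 1 = q := by rw [mulRight_apply, map_one, one_mul]
    have pI : plane i Complex.I = (i : ℍ) := by simp [plane_apply]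
    have e3 : mulRight i p Complex.I = (i : ℍ) * p := by rw [mulRight_apply, pI]
    have e4 : mulRight i q (-Complex.I) = -((i : ℍ) * q) := by
      rw [mulRight_apply, map_neg, pI, neg_mul]
    have d1 : HasDerivAt (fun s : ℝ => g ⟨s, v⟩) p u := by
      have := hp.comp_hasDerivAt u (hasDerivAt_mk_left u v)
      rwa [e1] at this
    have d2 : HasDerivAt (fun s : ℝ => g ⟨s, -v⟩) q u := by
      have := hq.comp_hasDerivAt u (hasDerivAt_mk_left u (-v))
      rwa [e2] at this
    have d3 : HasDerivAt (fun t : ℝ => g ⟨u, t⟩) ((i : ℍ) * p) v := by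
      have := hp.comp_hasDerivAt v (hasDerivAt_mk_right u v)
      rwa [e3] at this
    have d4 : HasDerivAt (fun t : ℝ => g ⟨u, -t⟩) (-((i : ℍ) * q)) v := by
      have hn : HasDerivAt (fun t : ℝ => (⟨u, -t⟩ : ℂ)) (-Complex.I) v := by
        have := (hasDerivAt_mk_right u (-v)).scomp v (hasDerivAt_neg v)
        rwa [neg_one_smul] at this
      have := hq.comp_hasDerivAt v hn
      rwa [e4] at this
    have hii := i.mul_self
    refine ⟨sliceExt_plane i I g u v, ?_, ?_, (2⁻¹ : ℝ) • (p + q),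
      (2⁻¹ : ℝ) • (-((i : ℍ) * (p - q))), (d1.add d2).const_smul (2⁻¹ : ℝ), ?_,
      (((d1.sub d2).const_mul (i : ℍ)).neg).const_smul (2⁻¹ : ℝ), ?_⟩
    · simp only [neg_neg]
      rw [add_comm]
    · simp only [neg_neg]
      rw [← smul_neg, ← neg_sub (g ⟨u, v⟩), mul_neg]
    · have := ((d3.sub d4).const_mul (i : ℍ)).neg.const_smul (2⁻¹ : ℝ)
      refine this.congr_deriv ?_
      rw [sub_neg_eq_add, ← mul_add, ← mul_assoc, hii, neg_one_mul, neg_neg]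
    · have := (d3.add d4).const_smul (2⁻¹ : ℝ)
      refine this.congr_deriv ?_
      rw [smul_neg, neg_neg, mul_sub, sub_eq_add_neg]

theorem IsLeftSliceHyperholomorphicOn.congr {f g : ℍ → ℍ} {U : Set ℍ}
    (hf : IsLeftSliceHyperholomorphicOn f U) (h : ∀ x ∈ U, g x = f x) :
    IsLeftSliceHyperholomorphicOn g U := by
  obtain ⟨hd, a, b, hab⟩ := hf
  refine ⟨hd.congr h, a, b, fun I u v hU => ?_⟩
  rw [h _ hU]
  exact hab I u v hU

/-- The function on `𝔻` that extends `g`, as an element of the Bergman space. -/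
def ofSlice {i : ImaginaryUnit} {α : ℝ} (g : ℂ → ℍ) (hg : IsHolomorphic i g)
    (hL : MeasureTheory.MemLp g 2 (areaMeasure α)) : BergmanSpace i α :=
  ⟨fun x => sliceExt i g x, by
    have he : ∀ x ∈ ball, extendZero (fun x => sliceExt i g x) x = sliceExt i g x :=
      fun x hx => extendZero_of_mem _ hx
    refine ⟨(sliceExt_isLeftSliceHyperholomorphicOn i g hg).congr he, ?_⟩
    refine (MeasureTheory.memLp_congr_ae ?_).2 hL
    refine (MeasureTheory.withDensity_absolutelyContinuous _ _).ae_le ?_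
    filter_upwards [MeasureTheory.ae_restrict_mem measurableSet_ball] with z hz
    rw [he _ ((plane_mem_ball i z).2 (mem_ball_zero_iff.1 hz)), sliceExt_plane_self]⟩

theorem hasFDerivAt_plane (i : ImaginaryUnit) (ζ : ℂ) :
    HasFDerivAt (plane i) (mulRight i 1) ζ := by
  have h : (plane i : ℂ → ℍ) = mulRight i 1 := by
    funext z; rw [mulRight_apply, mul_one]
  rw [h]
  exact (mulRight i 1).hasFDerivAt

theorem isHolomorphic_of_mem {i : ImaginaryUnit} {α : ℝ} (f : BergmanSpace i α) :
    IsHolomorphic i fun ζ => (i : ℍ) * extendZero f (plane i ζ) := by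
  obtain ⟨f, ⟨hd, a, b, hab⟩, hL⟩ := f
  intro ζ hζ
  obtain ⟨u, v⟩ := ζ
  have hb := (plane_mem_ball i ⟨u, v⟩).2 hζ
  obtain ⟨h1, h2, h3, p, q, h4, h5, h6, h7⟩ := hab i u v hb
  have hdf := (hd.differentiableAt (Metric.isOpen_ball.mem_nhds hb)).hasFDerivAt
  have hg : HasFDerivAt (fun ζ => extendZero f (plane i ζ)) _ (⟨u, v⟩ : ℂ) :=
    hdf.comp _ (hasFDerivAt_plane i ⟨u, v⟩)
  set L := (fderiv ℝ (extendZero f) (plane i ⟨u, v⟩)).comp (mulRight i 1) with hLdef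
  have o1 : ∀ᶠ s : ℝ in nhds u, ‖(⟨s, v⟩ : ℂ)‖ < 1 :=
    ((hasDerivAt_mk_left u v).continuousAt.norm).eventually_lt continuousAt_const hζ
  have o2 : ∀ᶠ t : ℝ in nhds v, ‖(⟨u, t⟩ : ℂ)‖ < 1 :=
    ((hasDerivAt_mk_right u v).continuousAt.norm).eventually_lt continuousAt_const hζ
  have c1 : HasDerivAt (fun s : ℝ => extendZero f (plane i ⟨s, v⟩)) (L 1) u :=
    HasFDerivAt.comp_hasDerivAt (l := fun ζ => extendZero f (plane i ζ)) u hg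
      (hasDerivAt_mk_left u v)
  have c2 : HasDerivAt (fun t : ℝ => extendZero f (plane i ⟨u, t⟩)) (L Complex.I) v :=
    HasFDerivAt.comp_hasDerivAt (l := fun ζ => extendZero f (plane i ζ)) v hg
      (hasDerivAt_mk_right u v)
  have c3 : HasDerivAt (fun s : ℝ => extendZero f (plane i ⟨s, v⟩)) (p + (i : ℍ) * q) u := by
    refine (h4.add (h6.const_mul (i : ℍ))).congr_of_eventuallyEq ?_
    filter_upwards [o1] with s hs
    exact (hab i s v ((plane_mem_ball i _).2 hs)).1
  have c4 : HasDerivAt (fun t : ℝ => extendZero f (plane i ⟨u, t⟩)) (-q + (i : ℍ) * p) v := by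
    refine (h7.add (h5.const_mul (i : ℍ))).congr_of_eventuallyEq ?_
    filter_upwards [o2] with t ht
    exact (hab i u t ((plane_mem_ball i _).2 ht)).1
  have l1 := c1.unique c3
  have l2 := c2.unique c4
  have hii := i.mul_self
  refine ⟨(i : ℍ) * (p + (i : ℍ) * q), ?_⟩
  have hm := hg.const_mul (i : ℍ)
  refine hm.congr_fderiv (ContinuousLinearMap.ext fun h => Eq.symm ?_)
  have hh : h = h.re • (1 : ℂ) + h.im • Complex.I := by
    rw [Complex.real_smul, Complex.real_smul, mul_one, Complex.re_add_im]
  change plane i h * ((i : ℍ) * (p + (i : ℍ) * q)) = (i : ℍ) * L h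
  have hLh : L h = h.re • (p + (i : ℍ) * q) + h.im • (-q + (i : ℍ) * p) := by
    conv_lhs => rw [hh]
    rw [map_add, map_smul, map_smul, l1, l2]
  have hph : plane i h = h.re • (1 : ℍ) + h.im • (i : ℍ) := by
    have h1 : (h.re : ℍ) = h.re • (1 : ℍ) := by rw [← Quaternion.coe_mul_eq_smul, mul_one]
    rw [plane_apply, h1]
  rw [hLh, hph]
  have hiq : (i : ℍ) * ((i : ℍ) * q) = -q := by rw [← mul_assoc, hii, neg_one_mul]
  have hip : (i : ℍ) * ((i : ℍ) * p) = -p := by rw [← mul_assoc, hii, neg_one_mul]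
  simp only [mul_add, add_mul, smul_mul_assoc, mul_smul_comm, one_mul, hiq, hip, mul_neg]
  module

/-- The unitary anti-selfadjoint operator `J f = ext (i f_i)` on `𝒜²_{α,i}(𝔻)`. -/
def J {i : ImaginaryUnit} {α : ℝ} (f : BergmanSpace i α) : BergmanSpace i α :=
  ofSlice (fun ζ => (i : ℍ) * extendZero f (plane i ζ)) (isHolomorphic_of_mem f)
    (f.2.2.const_mul (i : ℍ))

/-- `ℬ_J(𝒜²_{α,i}(𝔻))`: the bounded right linear operators that commute with `J`. -/
def commutantJ (i : ImaginaryUnit) (α : ℝ) :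
    Set (BergmanSpace i α →ₗ[ℍᵐᵒᵖ] BergmanSpace i α) :=
  {T | (∃ C : ℝ, ∀ f, bergmanNorm (T f) ≤ C * bergmanNorm f) ∧ ∀ f, T (J f) = J (T f)}

/-- The operator norm `sup {‖T f‖ : ‖f‖ = 1}`. -/
def operatorNorm {i : ImaginaryUnit} {α : ℝ} (T : BergmanSpace i α →ₗ[ℍᵐᵒᵖ] BergmanSpace i α) :
    ℝ :=
  sSup {r : ℝ | ∃ f : BergmanSpace i α, bergmanNorm f = 1 ∧ r = bergmanNorm (T f)}

theorem isFiniteMeasure_areaMeasure {α : ℝ} (hα : -1 < α) :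
    MeasureTheory.IsFiniteMeasure (areaMeasure α) := by
  have h1 : MeasureTheory.IntegrableOn (fun y : ℝ => y * (1 - y ^ 2) ^ α) (Set.Ioc 0 1) := by
    have hd : ∀ y ∈ Set.Ioo (0 : ℝ) 1,
        HasDerivAt (fun y : ℝ => -(1 - y ^ 2) ^ (α + 1) / (2 * (α + 1)))
          (y * (1 - y ^ 2) ^ α) y := by
      intro y hy
      have hpos : 0 < 1 - y ^ 2 := by nlinarith [hy.1, hy.2]
      have h := ((((hasDerivAt_id y).pow 2).const_sub 1).rpow_const (p := α + 1)
        (Or.inl hpos.ne')).neg.div_const (2 * (α + 1))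
      refine h.congr_deriv ?_
      have : α + 1 ≠ 0 := by linarith
      simp
      field_simp
    refine intervalIntegral.integrableOn_deriv_of_nonneg ?_ hd ?_
    · refine ContinuousOn.div_const (ContinuousOn.neg ?_) _
      exact ContinuousOn.rpow_const (by fun_prop) fun y _ => Or.inr (by linarith)
    · intro y hy
      have hpos : 0 < 1 - y ^ 2 := by nlinarith [hy.1, hy.2]
      exact mul_nonneg hy.1.le (Real.rpow_nonneg hpos.le _)
  have h2 : MeasureTheory.Integrable
      (fun z : ℂ => (Set.Iio (1 : ℝ)).indicator (fun y => (1 - y ^ 2) ^ α) ‖z‖) := by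
    refine (MeasureTheory.integrable_fun_norm_addHaar MeasureTheory.volume
      (f := (Set.Iio (1 : ℝ)).indicator (fun y => (1 - y ^ 2) ^ α))).2 ?_
    rw [Complex.finrank_real_complex]
    have e : (fun y : ℝ => y ^ (2 - 1) • (Set.Iio (1 : ℝ)).indicator
        (fun y => (1 - y ^ 2) ^ α) y) =
        (Set.Iio (1 : ℝ)).indicator fun y => y * (1 - y ^ 2) ^ α := by
      funext y
      by_cases h : y ∈ Set.Iio (1 : ℝ) <;> simp [h]
    rw [e, ← MeasureTheory.integrable_indicator_iff measurableSet_Ioi, Set.indicator_indicator,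
      MeasureTheory.integrable_indicator_iff (measurableSet_Ioi.inter measurableSet_Iio)]
    exact h1.mono_set fun y hy => ⟨hy.1, le_of_lt hy.2⟩
  have h3 : MeasureTheory.Integrable
      (fun z : ℂ => (α + 1) / Real.pi * (1 - ‖z‖ ^ 2) ^ α)
      (MeasureTheory.volume.restrict (Metric.ball (0 : ℂ) 1)) := by
    refine MeasureTheory.Integrable.const_mul ?_ _
    refine (h2.restrict (s := Metric.ball (0 : ℂ) 1)).congr ?_
    filter_upwards [MeasureTheory.ae_restrict_mem measurableSet_ball] with z hz
    have hz' : ‖z‖ ∈ Set.Iio (1 : ℝ) := mem_ball_zero_iff.1 hz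
    rw [Set.indicator_of_mem hz']
  exact MeasureTheory.isFiniteMeasure_withDensity_ofReal h3.2

/-- The complex Bergman kernel `(1 - z conj(w)) ^ (-(2 + α))`. -/
def complexKernel (α : ℝ) (z w : ℂ) : ℂ :=
  1 / (1 - z * (starRingEnd ℂ) w) ^ ((2 + α : ℝ) : ℂ)

theorem norm_coord_lt {i : ImaginaryUnit} (w : sliceDisc i) : ‖coord i w‖ < 1 := by
  obtain ⟨w, hw, ζ, rfl⟩ := w
  have h : coord i (plane i ζ) = ζ := by
    have hi := i.2.1
    have hn : inner ℝ (i : ℍ) (i : ℍ) = (1 : ℝ) := by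
      rw [real_inner_self_eq_norm_sq, i.2.2, one_pow]
    have h1 : inner ℝ (i : ℍ) ((ζ.re : ℝ) : ℍ) = (0 : ℝ) := by
      rw [Quaternion.inner_def]; simp [hi]
    apply Complex.ext
    · simp [coord, plane_apply, hi]
    · simp only [coord, plane_apply]
      rw [inner_add_right, inner_smul_right, hn, h1]; simp
  simp only [h]
  exact (plane_mem_ball i ζ).1 hw

theorem kernel_base {z w : ℂ} (hz : ‖z‖ < 1) (hw : ‖w‖ < 1) :
    0 < (1 - z * (starRingEnd ℂ) w).re := by
  have h := Complex.re_le_norm (z * (starRingEnd ℂ) w)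
  rw [norm_mul, Complex.norm_conj] at h
  rw [Complex.sub_re, Complex.one_re]
  nlinarith [norm_nonneg z, norm_nonneg w]

theorem kernel_isHolomorphic (i : ImaginaryUnit) (α : ℝ) {w : ℂ} (hw : ‖w‖ < 1) :
    IsHolomorphic i fun ζ => plane i (complexKernel α ζ w) := by
  intro ζ hζ
  have hpos := kernel_base hζ hw
  have hd : DifferentiableAt ℂ (fun ζ => complexKernel α ζ w) ζ := by
    unfold complexKernel
    have hb : DifferentiableAt ℂ (fun z : ℂ => 1 - z * (starRingEnd ℂ) w) ζ := by fun_prop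
    refine (differentiableAt_const _).div (hb.cpow_const (Or.inl hpos)) ?_
    rw [Ne, Complex.cpow_eq_zero_iff]
    rintro ⟨h, -⟩
    rw [h] at hpos
    exact lt_irrefl _ hpos
  have hr := hd.hasDerivAt.hasFDerivAt.restrictScalars ℝ
  refine ⟨plane i (deriv (fun ζ => complexKernel α ζ w) ζ), ?_⟩
  have hc : HasFDerivAt (fun ζ => plane i (complexKernel α ζ w)) _ ζ :=
    (hasFDerivAt_plane i _).comp ζ hr
  refine hc.congr_fderiv (ContinuousLinearMap.ext fun h => ?_)
  simp [mulRight_apply]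

theorem kernel_memLp (i : ImaginaryUnit) {α : ℝ} (hα : -1 < α) {w : ℂ} (hw : ‖w‖ < 1) :
    MeasureTheory.MemLp (fun ζ => plane i (complexKernel α ζ w)) 2 (areaMeasure α) := by
  have := isFiniteMeasure_areaMeasure hα
  have hac : (areaMeasure α).AbsolutelyContinuous
      (MeasureTheory.volume.restrict (Metric.ball (0 : ℂ) 1)) :=
    MeasureTheory.withDensity_absolutelyContinuous _ _
  refine MeasureTheory.MemLp.of_bound ?_ (1 / (1 - ‖w‖) ^ (2 + α)) ?_
  · refine MeasureTheory.AEStronglyMeasurable.mono_ac hac ?_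
    refine ContinuousOn.aestronglyMeasurable (fun ζ hζ => ?_) measurableSet_ball
    obtain ⟨p, hp⟩ := kernel_isHolomorphic i α hw ζ (mem_ball_zero_iff.1 hζ)
    exact hp.continuousAt.continuousWithinAt
  · refine hac.ae_le ?_
    filter_upwards [MeasureTheory.ae_restrict_mem measurableSet_ball] with z hz
    rw [mem_ball_zero_iff] at hz
    have h1 : 1 - ‖w‖ ≤ ‖1 - z * (starRingEnd ℂ) w‖ := by
      have h := norm_sub_norm_le (1 : ℂ) (z * (starRingEnd ℂ) w)
      rw [norm_one, norm_mul, Complex.norm_conj] at h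
      nlinarith [norm_nonneg z, norm_nonneg w]
    rw [norm_plane, complexKernel, norm_div, norm_one, Complex.norm_cpow_real]
    have h0 : 0 < 1 - ‖w‖ := by linarith
    gcongr
    linarith

/-- The slice hyperholomorphic `α`-Bergman kernel `K_w = K_α(·, w)` for `w ∈ 𝔻_i`, that is, the
slice extension of `z ↦ 1 / (1 - z conj(w)) ^ (2 + α)`. -/
def kernel {i : ImaginaryUnit} {α : ℝ} (hα : -1 < α) (w : sliceDisc i) : BergmanSpace i α :=
  ofSlice (fun ζ => plane i (complexKernel α ζ (coord i w)))
    (kernel_isHolomorphic i α (norm_coord_lt w)) (kernel_memLp i hα (norm_coord_lt w))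

/-- The normalized kernel `k_w = K_w / ‖K_w‖`. -/
def normalizedKernel {i : ImaginaryUnit} {α : ℝ} (hα : -1 < α) (w : sliceDisc i) :
    BergmanSpace i α :=
  MulOpposite.op (((bergmanNorm (kernel hα w))⁻¹ : ℝ) : ℍ) • kernel hα w

/-- The Berezin transform `z ↦ ⟨k_z, T k_z⟩` of `T` on `𝔻_i`. -/
def berezin {i : ImaginaryUnit} {α : ℝ} (hα : -1 < α)
    (T : BergmanSpace i α →ₗ[ℍᵐᵒᵖ] BergmanSpace i α) (z : sliceDisc i) : ℍ :=
  scalarProduct (normalizedKernel hα z) (T (normalizedKernel hα z))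

/-- The pseudo-hyperbolic metric `|z - w| / |1 - z conj(w)|`. -/
def pseudoHyperbolic (z w : ℍ) : ℝ := ‖z - w‖ / ‖1 - z * star w‖

end SliceBergman

end

open scoped Quaternion

noncomputable section

namespace SliceBergman

open MeasureTheory ComplexConjugate

/-! Reproducing property. Rotations preserve `areaMeasure α`, which has mass one, so averaging over
them and the mean value property on circles give `∫ h = h 0` for integrable holomorphic `h`
(`integral_areaMeasure_eq_apply_zero`). The involution `mobius w` exchanges `0` and `w`; under it
the measure picks up exactly the factor that turns the conjugated kernel into the kernel itself, so
`∫ conj K_w φ = K_w(0) φ(w) = φ(w)` (`integral_conj_complexKernel_mul`). A quaternionic `f` is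
reduced to this case through the complex holomorphic functions `coordL i (f q)`, `q ∈ ℍ`, which
together determine `f`.

Upper bound. For unit vectors `a`, `b` with `⟨a, b⟩ = r` real, the identity `2(⟨a, Ta⟩ - ⟨b, Tb⟩) =
⟨a - b, T(a + b)⟩ + ⟨a + b, T(a - b)⟩` and `‖a - b‖ ‖a + b‖ = 2 √(1 - r²)` bound the difference by
`2 ‖T‖ √(1 - r²)`. For normalized kernels the product lies in `ℂ_i` and becomes real after `b` is
multiplied from the right by a unimodular `c ∈ ℂ_i`. Commutation with `J` forces `⟨b, Tb⟩` to
commute with `i`, so this phase does not change it. Finally `|⟨k_z, k_w⟩|² = (1 - ρ²)^(2 + α)`, and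
Bernoulli's inequality gives `1 - (1 - ρ²)^(2 + α) ≤ (2 + α) ρ²`.

Sharpness. The difference of the projections onto `k_0` and `k_t`, `t` real, belongs to the
commutant, has norm at most `√(1 - r²)`, and its Berezin transform changes by `2(1 - r²)` between
the two points. Hence `2 √(1 - (1 - t²)^(2 + α)) ≤ C t`, and `t → 0` gives the constant. -/

/-! ### The weighted area measure and its mean value property -/

theorem integral_areaMeasure {α : ℝ} (hα : -1 < α) (g : ℂ → ℂ) :
    ∫ z, g z ∂(areaMeasure α) =
      ∫ z in Metric.ball (0 : ℂ) 1, ((α + 1) / Real.pi * (1 - ‖z‖ ^ 2) ^ α) • g z := by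
  rw [areaMeasure, integral_withDensity_eq_integral_toReal_smul (by fun_prop) (by simp)]
  refine setIntegral_congr_fun measurableSet_ball fun z hz => ?_
  have h1 : 0 ≤ 1 - ‖z‖ ^ 2 := by
    have := mem_ball_zero_iff.1 hz
    nlinarith [norm_nonneg z]
  have h2 : 0 ≤ α + 1 := by linarith
  rw [ENNReal.toReal_ofReal (by positivity)]

theorem integrable_areaMeasure_iff {α : ℝ} (hα : -1 < α) (g : ℂ → ℂ) :
    Integrable g (areaMeasure α) ↔ IntegrableOn
      (fun z => ((α + 1) / Real.pi * (1 - ‖z‖ ^ 2) ^ α) • g z) (Metric.ball (0 : ℂ) 1) := by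
  rw [areaMeasure, integrable_withDensity_iff_integrable_smul' (by fun_prop) (by simp)]
  refine integrableOn_congr_fun (fun z hz => ?_) measurableSet_ball
  have h1 : 0 ≤ 1 - ‖z‖ ^ 2 := by
    have := mem_ball_zero_iff.1 hz
    nlinarith [norm_nonneg z]
  have h2 : 0 ≤ α + 1 := by linarith
  rw [ENNReal.toReal_ofReal (by positivity)]

theorem integral_one_sub_sq_rpow {α : ℝ} (hα : -1 < α) :
    ∫ y in (0 : ℝ)..1, y * (1 - y ^ 2) ^ α = 1 / (2 * (α + 1)) := by
  have hα' : α + 1 ≠ 0 := by linarith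
  have hd : ∀ y ∈ Set.Ioo (0 : ℝ) 1,
      HasDerivAt (fun y : ℝ => -(1 - y ^ 2) ^ (α + 1) / (2 * (α + 1)))
        (y * (1 - y ^ 2) ^ α) y := by
    intro y hy
    have hpos : 0 < 1 - y ^ 2 := by nlinarith [hy.1, hy.2]
    have h := ((((hasDerivAt_id y).pow 2).const_sub 1).rpow_const (p := α + 1)
      (Or.inl hpos.ne')).neg.div_const (2 * (α + 1))
    refine h.congr_deriv ?_
    simp
    field_simp
  have hc : ContinuousOn (fun y : ℝ => -(1 - y ^ 2) ^ (α + 1) / (2 * (α + 1)))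
      (Set.Icc 0 1) := by
    refine ContinuousOn.div_const (ContinuousOn.neg ?_) _
    exact ContinuousOn.rpow_const (by fun_prop) fun y _ => Or.inr (by linarith)
  rw [intervalIntegral.integral_eq_sub_of_hasDerivAt_of_le zero_le_one hc hd]
  · simp [Real.zero_rpow hα']
    field_simp
  · rw [intervalIntegrable_iff_integrableOn_Ioc_of_le zero_le_one]
    -- For `α < 0` the integrand is unbounded near `1`; it is integrable as the nonnegative
    -- derivative of a function continuous up to the endpoint.
    refine intervalIntegral.integrableOn_deriv_of_nonneg hc hd fun y hy => ?_
    have hpos : 0 < 1 - y ^ 2 := by nlinarith [hy.1, hy.2]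
    exact mul_nonneg hy.1.le (Real.rpow_nonneg hpos.le _)

/-- The measure `dA_α` has total mass one. -/
theorem integral_one_areaMeasure {α : ℝ} (hα : -1 < α) :
    ∫ _, (1 : ℂ) ∂(areaMeasure α) = 1 := by
  have hα' : α + 1 ≠ 0 := by linarith
  rw [integral_areaMeasure hα]
  simp only [Complex.real_smul, mul_one]
  rw [integral_complex_ofReal, integral_const_mul, ← integral_indicator measurableSet_ball]
  have h : (Metric.ball (0 : ℂ) 1).indicator (fun z : ℂ => (1 - ‖z‖ ^ 2) ^ α) =
      fun z => (Set.Iio (1 : ℝ)).indicator (fun y => (1 - y ^ 2) ^ α) ‖z‖ := by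
    funext z
    by_cases h : ‖z‖ < 1 <;> simp [Set.indicator, h]
  rw [h, integral_fun_norm_addHaar, Complex.finrank_real_complex]
  have e : (fun y : ℝ => y ^ (2 - 1) • (Set.Iio (1 : ℝ)).indicator
      (fun y => (1 - y ^ 2) ^ α) y) =
      (Set.Iio (1 : ℝ)).indicator fun y => y * (1 - y ^ 2) ^ α := by
    funext y
    by_cases h : y ∈ Set.Iio (1 : ℝ) <;> simp [h]
  rw [e, setIntegral_indicator measurableSet_Iio, Set.Ioi_inter_Iio,
    ← integral_Ioc_eq_integral_Ioo, ← intervalIntegral.integral_of_le zero_le_one,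
    integral_one_sub_sq_rpow hα, Measure.real, Complex.volume_ball]
  simp only [ENNReal.ofReal_one, one_pow, one_mul, ENNReal.coe_toReal, NNReal.coe_real_pi,
    smul_eq_mul, nsmul_eq_mul]
  have := Real.pi_ne_zero
  rw [← Complex.ofReal_one]
  congr 1
  push_cast
  field_simp

/-- A rotation preserves Lebesgue measure, the disc, and the density, which depends on `‖z‖` only.
-/
theorem measurePreserving_mul_areaMeasure (α : ℝ) (c : Circle) :
    MeasurePreserving (fun z : ℂ => (c : ℂ) * z) (areaMeasure α) (areaMeasure α) := by
  have h0 : MeasurePreserving (fun z : ℂ => (c : ℂ) * z) volume volume :=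
    (rotation c).measurePreserving
  have hb : (fun z : ℂ => (c : ℂ) * z) ⁻¹' Metric.ball 0 1 = Metric.ball 0 1 := by
    ext z
    simp [Circle.norm_coe]
  have h1 := h0.restrict_preimage (measurableSet_ball (x := (0 : ℂ)) (ε := 1))
  rw [hb] at h1
  refine ⟨h0.measurable, ?_⟩
  ext s hs
  rw [Measure.map_apply h0.measurable hs, areaMeasure, withDensity_apply _ hs,
    withDensity_apply _ (h0.measurable hs)]
  have := h1.setLIntegral_comp_preimage hs
    (f := fun z => ENNReal.ofReal ((α + 1) / Real.pi * (1 - ‖z‖ ^ 2) ^ α)) (by fun_prop)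
  simpa [Circle.norm_coe] using this

theorem ae_areaMeasure_norm_lt (α : ℝ) : ∀ᵐ z ∂(areaMeasure α), ‖z‖ < 1 := by
  refine (withDensity_absolutelyContinuous _ _).ae_le ?_
  filter_upwards [ae_restrict_mem measurableSet_ball] with z hz
  exact mem_ball_zero_iff.1 hz

/-- Since `‖z‖ < 1`, the function `ζ ↦ h (ζ z)` is holomorphic up to the closed unit disc, so the
boundary behaviour of `h` plays no role. -/
theorem circleAverage_comp_mul {h : ℂ → ℂ} (hd : DifferentiableOn ℂ h (Metric.ball 0 1)) {z : ℂ}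
    (hz : ‖z‖ < 1) :
    ∫ θ in (0 : ℝ)..2 * Real.pi, h (Circle.exp θ * z) = 2 * Real.pi * h 0 := by
  have hm : ∀ ζ ∈ Metric.closedBall (0 : ℂ) 1, ζ * z ∈ Metric.ball (0 : ℂ) 1 := by
    intro ζ hζ
    rw [mem_closedBall_zero_iff] at hζ
    rw [mem_ball_zero_iff, norm_mul]
    nlinarith [norm_nonneg z, norm_nonneg ζ]
  have h1 : DifferentiableOn ℂ (fun ζ => h (ζ * z)) (Metric.closedBall 0 1) :=
    hd.comp (by fun_prop) hm
  have h2 : Real.circleAverage (fun ζ => h (ζ * z)) 0 1 = h (0 * z) := by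
    refine DiffContOnCl.circleAverage ?_
    rw [abs_one]
    refine DifferentiableOn.diffContOnCl ?_
    rwa [closure_ball _ one_ne_zero]
  rw [zero_mul, Real.circleAverage_def] at h2
  have h3 : ∀ θ : ℝ, circleMap 0 1 θ = Circle.exp θ := fun θ => by simp [circleMap]
  simp only [h3] at h2
  have h4 : (2 * Real.pi : ℂ) ≠ 0 := by simp
  rw [← h2, Complex.real_smul, Complex.ofReal_inv, Complex.ofReal_mul, Complex.ofReal_ofNat,
    mul_inv_cancel_left₀ h4]

/-- The mean value property of holomorphic functions with respect to `dA_α`. -/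
theorem integral_areaMeasure_eq_apply_zero {α : ℝ} (hα : -1 < α) {h : ℂ → ℂ}
    (hd : DifferentiableOn ℂ h (Metric.ball 0 1)) (hi : Integrable h (areaMeasure α)) :
    ∫ z, h z ∂(areaMeasure α) = h 0 := by
  have := isFiniteMeasure_areaMeasure hα
  have hpi := Real.pi_pos
  set ν : Measure ℝ := volume.restrict (Set.Ioc 0 (2 * Real.pi)) with hν
  -- The shear `(θ, z) ↦ (θ, e^{iθ} z)` preserves the product measure; this yields the joint
  -- integrability for Fubini from that of `h` alone.
  have hsk : MeasurePreserving
      (fun x : ℝ × ℂ => (x.1, (Circle.exp x.1 : ℂ) * x.2))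
      (ν.prod (areaMeasure α)) (ν.prod (areaMeasure α)) := by
    refine (MeasurePreserving.id ν).skew_product (g := fun θ z => (Circle.exp θ : ℂ) * z) ?_ ?_
    · have : Continuous (Function.uncurry fun (θ : ℝ) (z : ℂ) => (Circle.exp θ : ℂ) * z) := by
        unfold Function.uncurry
        fun_prop
      exact this.measurable
    · exact Filter.Eventually.of_forall fun θ =>
        (measurePreserving_mul_areaMeasure α (Circle.exp θ)).map_eq
  have hint : Integrable (Function.uncurry fun (θ : ℝ) (z : ℂ) => h (Circle.exp θ * z))
      (ν.prod (areaMeasure α)) :=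
    hsk.integrable_comp_of_integrable (hi.comp_snd ν)
  have hs := integral_integral_swap hint
  have hl : ∀ θ : ℝ, ∫ z, h (Circle.exp θ * z) ∂(areaMeasure α) = ∫ z, h z ∂(areaMeasure α) := by
    intro θ
    refine (measurePreserving_mul_areaMeasure α (Circle.exp θ)).integral_comp ?_ h
    exact (Homeomorph.mulLeft₀ (Circle.exp θ : ℂ) (Circle.coe_ne_zero _)).measurableEmbedding
  have hr : ∫ z, ∫ θ, h (Circle.exp θ * z) ∂ν ∂(areaMeasure α) =
      ∫ _, 2 * Real.pi * h 0 * 1 ∂(areaMeasure α) := by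
    refine integral_congr_ae ?_
    filter_upwards [ae_areaMeasure_norm_lt α] with z hz
    rw [hν, ← intervalIntegral.integral_of_le (by positivity), circleAverage_comp_mul hd hz,
      mul_one]
  rw [hr, integral_const_mul, integral_one_areaMeasure hα] at hs
  simp only [hl] at hs
  rw [integral_const, hν, measureReal_restrict_apply_univ, Real.volume_real_Ioc_of_le
    (by positivity), sub_zero, Complex.real_smul] at hs
  have h2 : (2 * Real.pi : ℂ) ≠ 0 := by simp [hpi.ne']
  push_cast at hs
  rw [mul_one] at hs
  exact mul_left_cancel₀ h2 hs

/-! ### Möbius involutions and the change of variables -/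

/-- The involutive automorphism of the unit disc that exchanges `0` and `w`. -/
def mobius (w ζ : ℂ) : ℂ := (w - ζ) / (1 - ζ * conj w)

theorem kernel_base_ne_zero {z w : ℂ} (hz : ‖z‖ < 1) (hw : ‖w‖ < 1) :
    1 - z * conj w ≠ 0 := by
  intro h
  have := kernel_base hz hw
  rw [h] at this
  exact lt_irrefl _ this

theorem one_sub_norm_sq_pos {w : ℂ} (hw : ‖w‖ < 1) : 0 < 1 - ‖w‖ ^ 2 := by
  nlinarith [norm_nonneg w]

theorem one_sub_norm_sq_ne_zero {w : ℂ} (hw : ‖w‖ < 1) : ((1 - ‖w‖ ^ 2 : ℝ) : ℂ) ≠ 0 :=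
  Complex.ofReal_ne_zero.2 (one_sub_norm_sq_pos hw).ne'

theorem ofReal_one_sub_norm_sq (w : ℂ) : ((1 - ‖w‖ ^ 2 : ℝ) : ℂ) = 1 - w * conj w := by
  rw [Complex.mul_conj']
  push_cast
  rfl

/-- This one identity yields both `1 - ‖mobius w z‖²` and `1 - ρ(z, w)²`. -/
theorem norm_kernel_base_sq (z w : ℂ) :
    ‖1 - z * conj w‖ ^ 2 - ‖w - z‖ ^ 2 = (1 - ‖w‖ ^ 2) * (1 - ‖z‖ ^ 2) := by
  simp only [Complex.sq_norm, Complex.normSq_apply, Complex.sub_re, Complex.sub_im,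
    Complex.mul_re, Complex.mul_im, Complex.conj_re, Complex.conj_im, Complex.one_re,
    Complex.one_im]
  ring

theorem one_sub_mobius_mul {z w : ℂ} (hz : ‖z‖ < 1) (hw : ‖w‖ < 1) :
    1 - mobius w z * conj w = ((1 - ‖w‖ ^ 2 : ℝ) : ℂ) / (1 - z * conj w) := by
  have := kernel_base_ne_zero hz hw
  rw [ofReal_one_sub_norm_sq, mobius]
  field_simp
  ring

theorem one_sub_norm_mobius_sq {z w : ℂ} (hz : ‖z‖ < 1) (hw : ‖w‖ < 1) :
    1 - ‖mobius w z‖ ^ 2 = (1 - ‖w‖ ^ 2) * (1 - ‖z‖ ^ 2) / ‖1 - z * conj w‖ ^ 2 := by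
  have := norm_ne_zero_iff.2 (kernel_base_ne_zero hz hw)
  rw [← norm_kernel_base_sq, mobius, norm_div]
  field_simp

theorem norm_mobius_lt {z w : ℂ} (hz : ‖z‖ < 1) (hw : ‖w‖ < 1) : ‖mobius w z‖ < 1 := by
  have h := one_sub_norm_mobius_sq hz hw
  have h1 := norm_pos_iff.2 (kernel_base_ne_zero hz hw)
  have h2 := one_sub_norm_sq_pos hz
  have h3 := one_sub_norm_sq_pos hw
  have h4 : 0 < 1 - ‖mobius w z‖ ^ 2 := by rw [h]; positivity
  nlinarith [norm_nonneg (mobius w z)]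

theorem mobius_mobius {z w : ℂ} (hz : ‖z‖ < 1) (hw : ‖w‖ < 1) : mobius w (mobius w z) = z := by
  have h := kernel_base_ne_zero hz hw
  have h1 := one_sub_norm_sq_ne_zero hw
  rw [mobius, one_sub_mobius_mul hz hw, div_eq_iff (div_ne_zero h1 h), ofReal_one_sub_norm_sq,
    mobius]
  field_simp
  ring

theorem mobius_zero (w : ℂ) : mobius w 0 = w := by simp [mobius]

theorem hasDerivAt_mobius {z w : ℂ} (hz : ‖z‖ < 1) (hw : ‖w‖ < 1) :
    HasDerivAt (mobius w) (-((1 - ‖w‖ ^ 2 : ℝ) : ℂ) / (1 - z * conj w) ^ 2) z := by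
  have h := kernel_base_ne_zero hz hw
  have h1 := ((hasDerivAt_id z).const_sub w).div
    (((hasDerivAt_id z).mul_const (conj w)).const_sub 1) h
  refine h1.congr_deriv ?_
  rw [ofReal_one_sub_norm_sq]
  simp only [id]
  congr 1
  ring

theorem mobius_image_ball {w : ℂ} (hw : ‖w‖ < 1) :
    mobius w '' Metric.ball 0 1 = Metric.ball 0 1 := by
  ext z
  simp only [Set.mem_image, mem_ball_zero_iff]
  constructor
  · rintro ⟨ζ, hζ, rfl⟩
    exact norm_mobius_lt hζ hw
  · exact fun hz => ⟨mobius w z, norm_mobius_lt hz hw, mobius_mobius hz hw⟩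

theorem mobius_injOn {w : ℂ} (hw : ‖w‖ < 1) : Set.InjOn (mobius w) (Metric.ball 0 1) := by
  intro x hx y hy h
  rw [mem_ball_zero_iff] at hx hy
  rw [← mobius_mobius hx hw, h, mobius_mobius hy hw]

/-- Multiplication by the complex number `a`, as a real linear map. -/
def mulLeftReal (a : ℂ) : ℂ →L[ℝ] ℂ := (ContinuousLinearMap.toSpanSingleton ℂ a).restrictScalars ℝ

theorem det_mulLeftReal (a : ℂ) : (mulLeftReal a).det = ‖a‖ ^ 2 := by
  have h : ((mulLeftReal a : ℂ →L[ℝ] ℂ) : ℂ →ₗ[ℝ] ℂ) = LinearMap.mul ℝ ℂ a := by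
    ext; simp [mulLeftReal, mul_comm]
  rw [ContinuousLinearMap.det, h]
  have := congrArg (fun f => f a) Algebra.norm_complex_eq
  rw [Complex.sq_norm]
  exact this

theorem hasFDerivWithinAt_mobius {w : ℂ} (hw : ‖w‖ < 1) (z : ℂ) (hz : z ∈ Metric.ball (0 : ℂ) 1) :
    HasFDerivWithinAt (mobius w)
      (mulLeftReal (-((1 - ‖w‖ ^ 2 : ℝ) : ℂ) / (1 - z * conj w) ^ 2)) (Metric.ball 0 1) z :=
  ((hasDerivAt_mobius (mem_ball_zero_iff.1 hz) hw).hasFDerivAt.restrictScalars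
    ℝ).hasFDerivWithinAt

theorem abs_det_mobius {w : ℂ} (z : ℂ) (hw : ‖w‖ < 1) :
    |(mulLeftReal (-((1 - ‖w‖ ^ 2 : ℝ) : ℂ) / (1 - z * conj w) ^ 2)).det| =
      (1 - ‖w‖ ^ 2) ^ 2 / ‖1 - z * conj w‖ ^ 4 := by
  rw [det_mulLeftReal, abs_of_nonneg (by positivity), norm_div, norm_neg, norm_pow,
    Complex.norm_real, Real.norm_of_nonneg (one_sub_norm_sq_pos hw).le, div_pow]
  ring

/-- The real Jacobian contributes the exponent `2` and the transformed density the exponent `α`. -/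
theorem jacobian_weight {α : ℝ} {z w : ℂ} (hz : ‖z‖ < 1) (hw : ‖w‖ < 1) :
    |(mulLeftReal (-((1 - ‖w‖ ^ 2 : ℝ) : ℂ) / (1 - z * conj w) ^ 2)).det| *
      ((α + 1) / Real.pi * (1 - ‖mobius w z‖ ^ 2) ^ α) =
    ((α + 1) / Real.pi * (1 - ‖z‖ ^ 2) ^ α) *
      ((1 - ‖w‖ ^ 2) / ‖1 - z * conj w‖ ^ 2) ^ (2 + α) := by
  have h1 := norm_pos_iff.2 (kernel_base_ne_zero hz hw)
  have h2 := one_sub_norm_sq_pos hz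
  have h3 := one_sub_norm_sq_pos hw
  rw [abs_det_mobius z hw, one_sub_norm_mobius_sq hz hw, mul_div_right_comm,
    Real.mul_rpow (by positivity) h2.le, Real.rpow_add (by positivity), Real.rpow_two]
  ring

theorem integral_areaMeasure_mobius {α : ℝ} (hα : -1 < α) {w : ℂ} (hw : ‖w‖ < 1) (g : ℂ → ℂ) :
    ∫ z, g z ∂(areaMeasure α) =
      ∫ z, ((((1 - ‖w‖ ^ 2) / ‖1 - z * conj w‖ ^ 2) ^ (2 + α) : ℝ) : ℂ) * g (mobius w z)
        ∂(areaMeasure α) := by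
  rw [integral_areaMeasure hα, integral_areaMeasure hα]
  conv_lhs => rw [← mobius_image_ball hw]
  rw [integral_image_eq_integral_abs_det_fderiv_smul _ measurableSet_ball
    (hasFDerivWithinAt_mobius hw) (mobius_injOn hw)]
  refine setIntegral_congr_fun measurableSet_ball fun z hz => ?_
  rw [smul_smul, jacobian_weight (mem_ball_zero_iff.1 hz) hw, ← smul_smul, ← Complex.real_smul]

theorem integrable_areaMeasure_mobius {α : ℝ} (hα : -1 < α) {w : ℂ} (hw : ‖w‖ < 1) {g : ℂ → ℂ}
    (hg : Integrable g (areaMeasure α)) :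
    Integrable (fun z => ((((1 - ‖w‖ ^ 2) / ‖1 - z * conj w‖ ^ 2) ^ (2 + α) : ℝ) : ℂ) *
      g (mobius w z)) (areaMeasure α) := by
  rw [integrable_areaMeasure_iff hα] at hg ⊢
  rw [← mobius_image_ball hw, integrableOn_image_iff_integrableOn_abs_det_fderiv_smul _
    measurableSet_ball (hasFDerivWithinAt_mobius hw) (mobius_injOn hw)] at hg
  refine hg.congr_fun (fun z hz => ?_) measurableSet_ball
  simp only
  rw [smul_smul, jacobian_weight (mem_ball_zero_iff.1 hz) hw, ← smul_smul, ← Complex.real_smul]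

/-! ### The complex reproducing kernel -/

/-- In the right half-plane the argument is never `π`, so the principal power respects inversion;
positive real factors never disturb the branch. -/
theorem ofReal_div_cpow {s : ℝ} (hs : 0 < s) {x : ℂ} (hx : 0 < x.re) (p : ℝ) :
    ((s : ℂ) / x) ^ (p : ℂ) = ((s ^ p : ℝ) : ℂ) / x ^ (p : ℂ) := by
  have hx0 : x ≠ 0 := fun h => by simp [h] at hx
  have harg : x.arg ≠ Real.pi := by
    intro h
    have := Complex.arg_eq_pi_iff.1 h
    linarith [this.1]
  rw [div_eq_mul_inv, Complex.cpow_def_of_ne_zero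
    (mul_ne_zero (Complex.ofReal_ne_zero.2 hs.ne') (inv_ne_zero hx0)),
    Complex.log_ofReal_mul hs (inv_ne_zero hx0), add_mul, Complex.exp_add, div_eq_mul_inv,
    ← Complex.inv_cpow _ _ harg, Complex.cpow_def_of_ne_zero (inv_ne_zero hx0),
    Complex.ofReal_cpow hs.le, Complex.cpow_def_of_ne_zero (Complex.ofReal_ne_zero.2 hs.ne'),
    Complex.ofReal_log hs.le]

/-- With `x = 1 - z conj w` and `p = 2 + α`, the kernel at `mobius w z` is `x^p / (1 - ‖w‖²)^p`, and
`conj (x^p) / ‖x^p‖² = 1 / x^p`. -/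
theorem weight_mul_conj_complexKernel (α : ℝ) {z w : ℂ} (hz : ‖z‖ < 1) (hw : ‖w‖ < 1) :
    ((((1 - ‖w‖ ^ 2) / ‖1 - z * conj w‖ ^ 2) ^ (2 + α) : ℝ) : ℂ) *
      conj (complexKernel α (mobius w z) w) = complexKernel α z w := by
  have h1 := norm_pos_iff.2 (kernel_base_ne_zero hz hw)
  have h2 := one_sub_norm_sq_pos hw
  have h3 : (1 - z * conj w) ^ ((2 + α : ℝ) : ℂ) ≠ 0 := by
    rw [Ne, Complex.cpow_eq_zero_iff]
    exact fun h => kernel_base_ne_zero hz hw h.1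
  have h4 : (‖1 - z * conj w‖ ^ 2) ^ (2 + α) = ‖(1 - z * conj w) ^ ((2 + α : ℝ) : ℂ)‖ ^ 2 := by
    rw [Complex.norm_cpow_real, ← Real.rpow_two, ← Real.rpow_mul h1.le, mul_comm (2 : ℝ),
      Real.rpow_mul h1.le, Real.rpow_two]
  have h5 : (((1 - ‖w‖ ^ 2) ^ (2 + α) : ℝ) : ℂ) ≠ 0 :=
    Complex.ofReal_ne_zero.2 (Real.rpow_pos_of_pos h2 _).ne'
  rw [complexKernel, complexKernel, one_sub_mobius_mul hz hw,
    ofReal_div_cpow h2 (kernel_base hz hw), Real.div_rpow h2.le (by positivity), h4,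
    Complex.ofReal_div, Complex.ofReal_pow, ← Complex.mul_conj', one_div_div, map_div₀,
    Complex.conj_ofReal]
  have h6 := (map_ne_zero (starRingEnd ℂ)).2 h3
  field_simp

theorem differentiableOn_complexKernel (α : ℝ) {w : ℂ} (hw : ‖w‖ < 1) :
    DifferentiableOn ℂ (fun z => complexKernel α z w) (Metric.ball 0 1) := by
  intro ζ hζ
  have hpos := kernel_base (mem_ball_zero_iff.1 hζ) hw
  unfold complexKernel
  have hb : DifferentiableAt ℂ (fun z : ℂ => 1 - z * conj w) ζ := by fun_prop
  refine ((differentiableAt_const _).div (hb.cpow_const (Or.inl hpos)) ?_).differentiableWithinAt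
  rw [Ne, Complex.cpow_eq_zero_iff]
  exact fun h => kernel_base_ne_zero (mem_ball_zero_iff.1 hζ) hw h.1

theorem complexKernel_zero_left (α : ℝ) (w : ℂ) : complexKernel α 0 w = 1 := by
  simp [complexKernel]

/-- The reproducing property of the complex Bergman kernel, for integrable functions. -/
theorem integral_conj_complexKernel_mul {α : ℝ} (hα : -1 < α) {w : ℂ} (hw : ‖w‖ < 1) {φ : ℂ → ℂ}
    (hd : DifferentiableOn ℂ φ (Metric.ball 0 1))
    (hi : Integrable (fun z => conj (complexKernel α z w) * φ z) (areaMeasure α)) :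
    ∫ z, conj (complexKernel α z w) * φ z ∂(areaMeasure α) = φ w := by
  -- After the substitution the antiholomorphic factor has become holomorphic, so the mean value
  -- property applies to the whole integrand.
  have he : (fun z => ((((1 - ‖w‖ ^ 2) / ‖1 - z * conj w‖ ^ 2) ^ (2 + α) : ℝ) : ℂ) *
      (conj (complexKernel α (mobius w z) w) * φ (mobius w z))) =ᵐ[areaMeasure α]
      fun z => complexKernel α z w * φ (mobius w z) := by
    filter_upwards [ae_areaMeasure_norm_lt α] with z hz
    rw [← mul_assoc, weight_mul_conj_complexKernel α hz hw]
  rw [integral_areaMeasure_mobius hα hw, integral_congr_ae he,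
    integral_areaMeasure_eq_apply_zero hα _ ((integrable_areaMeasure_mobius hα hw hi).congr he),
    complexKernel_zero_left, mobius_zero, one_mul]
  refine (differentiableOn_complexKernel α hw).mul (hd.comp (fun z hz => ?_) fun z hz => ?_)
  · exact (hasDerivAt_mobius (mem_ball_zero_iff.1 hz) hw).differentiableAt.differentiableWithinAt
  · exact mem_ball_zero_iff.2 (norm_mobius_lt (mem_ball_zero_iff.1 hz) hw)

/-! ### The right quaternionic scalar product and the operator norm -/

variable {i : ImaginaryUnit} {α : ℝ}

/-- The restriction of a function in the Bergman space to the plane `ℂ_i`, as a function on `ℂ`. -/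
def restr (f : BergmanSpace i α) (ζ : ℂ) : ℍ := extendZero f (plane i ζ)

theorem restr_add (f g : BergmanSpace i α) (ζ : ℂ) : restr (f + g) ζ = restr f ζ + restr g ζ :=
  congrFun (extendZero_add f.1 g.1) _

theorem restr_smul (c : ℍᵐᵒᵖ) (f : BergmanSpace i α) (ζ : ℂ) :
    restr (c • f) ζ = restr f ζ * c.unop :=
  congrFun (extendZero_smul c f.1) _

theorem memLp_restr (f : BergmanSpace i α) : MemLp (restr f) 2 (areaMeasure α) := f.2.2

theorem restr_ofSlice (g : ℂ → ℍ) (hg : IsHolomorphic i g) (hL : MemLp g 2 (areaMeasure α))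
    {ζ : ℂ} (hζ : ‖ζ‖ < 1) : restr (ofSlice g hg hL) ζ = g ζ :=
  (extendZero_of_mem _ ((plane_mem_ball i ζ).2 hζ)).trans (sliceExt_plane_self i g ζ)

theorem restr_J (f : BergmanSpace i α) {ζ : ℂ} (hζ : ‖ζ‖ < 1) :
    restr (J f) ζ = (i : ℍ) * restr f ζ :=
  restr_ofSlice _ _ _ hζ

/-- Holomorphy is known for `i f`; left multiplication by `-i` recovers `f` and keeps the form of
the derivative because `i` commutes with `ℂ_i`. -/
theorem isHolomorphic_restr (f : BergmanSpace i α) : IsHolomorphic i (restr f) := by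
  intro ζ hζ
  obtain ⟨p, hp⟩ := isHolomorphic_of_mem f ζ hζ
  have hii := i.mul_self
  have h1 := hp.const_mul (-(i : ℍ))
  have h2 : (fun ζ => -(i : ℍ) * ((i : ℍ) * extendZero f (plane i ζ))) = restr f := by
    funext ζ
    rw [← mul_assoc, neg_mul, hii, neg_neg, one_mul]
    rfl
  rw [h2] at h1
  refine ⟨-(i : ℍ) * p, h1.congr_fderiv (ContinuousLinearMap.ext fun h => ?_)⟩
  change -(i : ℍ) * (plane i h * p) = plane i h * (-(i : ℍ) * p)
  have hc : (i : ℍ) * plane i h = plane i h * (i : ℍ) := by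
    have : (i : ℍ) = plane i Complex.I := by simp [plane_apply]
    rw [this, ← map_mul, ← map_mul, mul_comm]
  rw [neg_mul, ← mul_assoc, hc, neg_mul, mul_neg, mul_assoc]

theorem scalarProduct_eq (f g : BergmanSpace i α) :
    scalarProduct f g = ∫ z, star (restr f z) * restr g z ∂(areaMeasure α) := rfl

theorem integrable_star_mul (f g : BergmanSpace i α) :
    Integrable (fun z => star (restr f z) * restr g z) (areaMeasure α) :=
  (memLp_restr f).star.integrable_mul (memLp_restr g)

theorem scalarProduct_add_right (f g h : BergmanSpace i α) :
    scalarProduct f (g + h) = scalarProduct f g + scalarProduct f h := by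
  simp only [scalarProduct_eq, restr_add, mul_add]
  exact integral_add (integrable_star_mul f g) (integrable_star_mul f h)

theorem scalarProduct_sub_right (f g h : BergmanSpace i α) :
    scalarProduct f (g - h) = scalarProduct f g - scalarProduct f h := by
  rw [eq_sub_iff_add_eq, ← scalarProduct_add_right, sub_add_cancel]

theorem scalarProduct_smul_right (c : ℍᵐᵒᵖ) (f g : BergmanSpace i α) :
    scalarProduct f (c • g) = scalarProduct f g * c.unop := by
  simp only [scalarProduct_eq, restr_smul, ← mul_assoc]
  exact integral_mul_const_of_integrable (integrable_star_mul f g)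

/-- Quaternionic conjugation as a real linear map. -/
def starLinear : ℍ →ₗ[ℝ] ℍ where
  toFun := star
  map_add' := star_add
  map_smul' := Quaternion.star_smul

theorem star_scalarProduct (f g : BergmanSpace i α) :
    star (scalarProduct f g) = scalarProduct g f := by
  have h := (LinearMap.toContinuousLinearMap (starLinear : ℍ →ₗ[ℝ] ℍ)).integral_comp_comm
    (integrable_star_mul f g)
  simp only [scalarProduct_eq]
  refine h.symm.trans (integral_congr_ae (Filter.Eventually.of_forall fun z => ?_))
  change star (star (restr f z) * restr g z) = _
  rw [star_mul, star_star]

theorem scalarProduct_add_left (f g h : BergmanSpace i α) :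
    scalarProduct (f + g) h = scalarProduct f h + scalarProduct g h := by
  rw [← star_scalarProduct, scalarProduct_add_right, star_add, star_scalarProduct,
    star_scalarProduct]

theorem scalarProduct_sub_left (f g h : BergmanSpace i α) :
    scalarProduct (f - g) h = scalarProduct f h - scalarProduct g h := by
  rw [eq_sub_iff_add_eq, ← scalarProduct_add_left, sub_add_cancel]

theorem scalarProduct_smul_left (c : ℍᵐᵒᵖ) (f g : BergmanSpace i α) :
    scalarProduct (c • f) g = star c.unop * scalarProduct f g := by
  rw [← star_scalarProduct, scalarProduct_smul_right, star_mul, star_scalarProduct]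

theorem bergmanNorm_nonneg (f : BergmanSpace i α) : 0 ≤ bergmanNorm f := Real.sqrt_nonneg _

theorem bergmanNorm_sq (f : BergmanSpace i α) :
    bergmanNorm f ^ 2 = ∫ z, ‖restr f z‖ ^ 2 ∂(areaMeasure α) :=
  Real.sq_sqrt (integral_nonneg fun _ => by positivity)

theorem scalarProduct_self (f : BergmanSpace i α) :
    scalarProduct f f = ((bergmanNorm f ^ 2 : ℝ) : ℍ) := by
  have h : ∀ z, star (restr f z) * restr f z = (‖restr f z‖ ^ 2) • (1 : ℍ) := fun z => by
    rw [Quaternion.star_mul_self, Quaternion.normSq_eq_norm_mul_self, ← sq,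
      ← Quaternion.coe_mul_eq_smul, mul_one]
  rw [scalarProduct_eq, bergmanNorm_sq]
  simp only [h]
  rw [integral_smul_const, ← Quaternion.coe_mul_eq_smul, mul_one]

theorem bergmanNorm_smul (c : ℍᵐᵒᵖ) (f : BergmanSpace i α) :
    bergmanNorm (c • f) = bergmanNorm f * ‖c.unop‖ := by
  refine (sq_eq_sq₀ (bergmanNorm_nonneg _)
    (mul_nonneg (bergmanNorm_nonneg _) (norm_nonneg _))).1 ?_
  rw [mul_pow, bergmanNorm_sq, bergmanNorm_sq, ← integral_mul_const]
  simp only [restr_smul, norm_mul, mul_pow]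

/-- The Cauchy-Schwarz inequality. -/
theorem norm_scalarProduct_le (f g : BergmanSpace i α) :
    ‖scalarProduct f g‖ ≤ bergmanNorm f * bergmanNorm g := by
  have h2 : ENNReal.ofReal 2 = 2 := by simp
  have h := integral_mul_le_Lp_mul_Lq_of_nonneg (μ := areaMeasure α)
    (f := fun z => ‖restr f z‖) (g := fun z => ‖restr g z‖) Real.HolderConjugate.two_two
    (Filter.Eventually.of_forall fun _ => norm_nonneg _)
    (Filter.Eventually.of_forall fun _ => norm_nonneg _)
    (by rw [h2]; exact (memLp_restr f).norm) (by rw [h2]; exact (memLp_restr g).norm)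
  simp only [Real.rpow_two, ← Real.sqrt_eq_rpow] at h
  refine (norm_integral_le_integral_norm _).trans (le_trans (le_of_eq ?_) h)
  simp only [norm_mul, norm_star]
  rfl

theorem bergmanNorm_le_operatorNorm_mul {T : BergmanSpace i α →ₗ[ℍᵐᵒᵖ] BergmanSpace i α}
    (hT : ∃ C : ℝ, ∀ f, bergmanNorm (T f) ≤ C * bergmanNorm f) (f : BergmanSpace i α) :
    bergmanNorm (T f) ≤ operatorNorm T * bergmanNorm f := by
  obtain ⟨C, hC⟩ := hT
  -- A vector of norm zero cannot be normalized; there the bound `C` already gives `‖T f‖ ≤ 0`.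
  rcases eq_or_ne (bergmanNorm f) 0 with h0 | h0
  · have := hC f
    rw [h0, mul_zero] at this ⊢
    exact this
  have hpos : 0 < bergmanNorm f := lt_of_le_of_ne (bergmanNorm_nonneg f) h0.symm
  set c : ℍᵐᵒᵖ := MulOpposite.op (((bergmanNorm f)⁻¹ : ℝ) : ℍ) with hc
  have hcn : ‖c.unop‖ = (bergmanNorm f)⁻¹ := by
    rw [hc, MulOpposite.unop_op, Quaternion.norm_coe, Real.norm_of_nonneg (by positivity)]
  have hb : BddAbove {r : ℝ | ∃ f : BergmanSpace i α, bergmanNorm f = 1 ∧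
      r = bergmanNorm (T f)} := by
    refine ⟨C, ?_⟩
    rintro r ⟨g, hg, rfl⟩
    have := hC g
    rwa [hg, mul_one] at this
  have h1 : bergmanNorm (T (c • f)) ≤ operatorNorm T :=
    le_csSup hb ⟨c • f, by rw [bergmanNorm_smul, hcn, mul_inv_cancel₀ h0], rfl⟩
  rw [map_smul, bergmanNorm_smul, hcn, ← div_eq_mul_inv, div_le_iff₀ hpos] at h1
  exact h1

theorem operatorNorm_nonneg (T : BergmanSpace i α →ₗ[ℍᵐᵒᵖ] BergmanSpace i α) :
    0 ≤ operatorNorm T :=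
  Real.sSup_nonneg fun _ ⟨_, _, hr⟩ => hr ▸ bergmanNorm_nonneg _

/-! ### The operator `J` -/

theorem sliceExt_add (g h : ℂ → ℍ) (x : ℍ) :
    sliceExt i (fun ζ => g ζ + h ζ) x = sliceExt i g x + sliceExt i h x := by
  simp only [sliceExt, mul_add, smul_add]
  abel

theorem sliceExt_mul_const (g : ℂ → ℍ) (c x : ℍ) :
    sliceExt i (fun ζ => g ζ * c) x = sliceExt i g x * c := by
  simp only [sliceExt, add_mul, smul_mul_assoc, mul_assoc]

theorem sliceExt_congr {g h : ℂ → ℍ} (hgh : ∀ ζ, ‖ζ‖ < 1 → g ζ = h ζ) {x : ℍ} (hx : ‖x‖ < 1) :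
    sliceExt i g x = sliceExt i h x := by
  rw [sliceExt, sliceExt, hgh _ (by rwa [norm_mk_im]), hgh _ (by rwa [norm_mk_neg, norm_mk_im])]

theorem J_apply (f : BergmanSpace i α) (x : ball) :
    (J f).1 x = sliceExt i (fun ζ => (i : ℍ) * restr f ζ) x := rfl

theorem coe_smul_apply (c : ℍᵐᵒᵖ) (f : BergmanSpace i α) (x : ball) :
    (c • f).1 x = f.1 x * c.unop := rfl

theorem coe_add_apply (f g : BergmanSpace i α) (x : ball) : (f + g).1 x = f.1 x + g.1 x := rfl

theorem J_add (f g : BergmanSpace i α) : J (f + g) = J f + J g := by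
  refine Subtype.ext (funext fun x => ?_)
  rw [coe_add_apply, J_apply, J_apply, J_apply, ← sliceExt_add]
  simp only [restr_add, mul_add]

theorem J_smul (c : ℍᵐᵒᵖ) (f : BergmanSpace i α) : J (c • f) = c • J f := by
  refine Subtype.ext (funext fun x => ?_)
  rw [coe_smul_apply, J_apply, J_apply, ← sliceExt_mul_const]
  simp only [restr_smul, mul_assoc]

theorem J_sub (f g : BergmanSpace i α) : J (f - g) = J f - J g := by
  rw [eq_sub_iff_add_eq, ← J_add, sub_add_cancel]

/-- Values commuting with `i` let the left factor `i` pass to the right, where it is a scalar of the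
right vector space. The kernels are of this kind. -/
theorem J_ofSlice (g : ℂ → ℍ) (hg : IsHolomorphic i g) (hL : MemLp g 2 (areaMeasure α))
    (hc : ∀ ζ, (i : ℍ) * g ζ = g ζ * (i : ℍ)) :
    J (ofSlice g hg hL) = MulOpposite.op (i : ℍ) • ofSlice g hg hL := by
  refine Subtype.ext (funext fun x => ?_)
  rw [coe_smul_apply, J_apply]
  refine Eq.trans ?_ (sliceExt_mul_const g (i : ℍ) x)
  refine sliceExt_congr (fun ζ hζ => ?_) (mem_ball_zero_iff.1 x.2)
  rw [← hc]
  exact congrArg _ (restr_ofSlice g hg hL hζ)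

theorem mul_plane_comm {x : ℍ} (h : (i : ℍ) * x = x * (i : ℍ)) (c : ℂ) :
    plane i c * x = x * plane i c := by
  rw [plane_apply, add_mul, mul_add, smul_mul_assoc, mul_smul_comm, h, Quaternion.coe_commutes]

theorem imaginaryUnit_eq_plane (i : ImaginaryUnit) : (i : ℍ) = plane i Complex.I := by
  simp [plane_apply]

theorem imaginaryUnit_mul_plane (c : ℂ) : (i : ℍ) * plane i c = plane i c * (i : ℍ) := by
  rw [imaginaryUnit_eq_plane, ← map_mul, ← map_mul, mul_comm]

theorem star_imaginaryUnit (i : ImaginaryUnit) : star (i : ℍ) = -(i : ℍ) := by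
  ext <;> simp [i.2.1]

theorem star_plane (c : ℂ) : star (plane i c) = plane i (conj c) := by
  rw [plane_apply, plane_apply, star_add, Quaternion.star_coe, Quaternion.star_smul,
    star_imaginaryUnit]
  simp

/-- For `a` with values in `ℂ_i`, the functional `⟨a, ·⟩` intertwines `J` and multiplication by `i`
from the left. -/
theorem scalarProduct_J {a : BergmanSpace i α} (ha : J a = MulOpposite.op (i : ℍ) • a)
    (f : BergmanSpace i α) : scalarProduct a (J f) = (i : ℍ) * scalarProduct a f := by
  have h1 : ∀ᵐ z ∂(areaMeasure α), star (restr a z) * restr (J f) z =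
      (i : ℍ) * (star (restr a z) * restr f z) := by
    filter_upwards [ae_areaMeasure_norm_lt α] with z hz
    have h2 : (i : ℍ) * restr a z = restr a z * (i : ℍ) := by
      rw [← restr_J a hz, ha, restr_smul, MulOpposite.unop_op]
    have h3 := congrArg star h2
    rw [star_mul, star_mul, star_imaginaryUnit, mul_neg, neg_mul, neg_inj] at h3
    rw [restr_J f hz, ← mul_assoc, h3, mul_assoc]
  rw [scalarProduct_eq, integral_congr_ae h1]
  exact integral_const_mul_of_integrable (integrable_star_mul a f)

/-! ### Projection to `ℂ_i` and the slice reproducing property -/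

theorem inner_imaginaryUnit_self (i : ImaginaryUnit) : inner ℝ (i : ℍ) (i : ℍ) = (1 : ℝ) := by
  rw [real_inner_self_eq_norm_sq, i.2.2, one_pow]

/-- The coordinate of the projection to `ℂ_i` as a continuous real linear map. -/
def coordL (i : ImaginaryUnit) : ℍ →L[ℝ] ℂ :=
  LinearMap.toContinuousLinearMap
    { toFun := coord i
      map_add' := fun x y => by
        apply Complex.ext <;> simp [coord, inner_add_right]
      map_smul' := fun c x => by
        apply Complex.ext <;> simp [coord, inner_smul_right] }

theorem coordL_apply (x : ℍ) : coordL i x = coord i x := rfl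

/-- The projection is complex linear for left multiplication by `ℂ_i`, hence carries `i`-holomorphic
functions to holomorphic ones. -/
theorem coordL_plane_mul (z : ℂ) (x : ℍ) : coordL i (plane i z * x) = z * coordL i x := by
  have h := inner_imaginaryUnit_self i
  have h0 := i.2.1
  rw [Quaternion.inner_def] at h
  simp [h0] at h
  apply Complex.ext
  · simp [coordL_apply, coord, plane_apply, Quaternion.inner_def, h0]
    ring
  · simp [coordL_apply, coord, plane_apply, Quaternion.inner_def, h0]
    linear_combination (z.im * x.re) * h

theorem coord_plane (ζ : ℂ) : coord i (plane i ζ) = ζ := by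
  have h := coordL_plane_mul (i := i) ζ 1
  have h1 : coordL i 1 = 1 := by
    apply Complex.ext <;> simp [coordL_apply, coord, Quaternion.inner_def, i.2.1]
  rwa [mul_one, h1, mul_one] at h

theorem plane_coord (w : sliceDisc i) : plane i (coord i w) = w := by
  obtain ⟨w, hw, ζ, rfl⟩ := w
  rw [coord_plane]

/-- The choice `q = star (x - y)` makes `(x - y) q` the real number `|x - y|²`, which the projection
retains. -/
theorem eq_of_coordL_mul {x y : ℍ} (h : ∀ q, coordL i (x * q) = coordL i (y * q)) : x = y := by
  have h1 := h (star (x - y))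
  rw [← sub_eq_zero, ← map_sub, ← sub_mul, Quaternion.self_mul_star] at h1
  have h2 := congrArg Complex.re h1
  exact sub_eq_zero.1 (Quaternion.normSq_eq_zero.1 h2)

/-- Right multiplication by `q` does not interfere with holomorphy, where `ℂ_i` acts from the left.
-/
theorem differentiableOn_coordL_restr (f : BergmanSpace i α) (q : ℍ) :
    DifferentiableOn ℂ (fun ζ => coordL i (restr f ζ * q)) (Metric.ball 0 1) := by
  intro ζ hζ
  obtain ⟨p, hp⟩ := isHolomorphic_restr f ζ (mem_ball_zero_iff.1 hζ)
  have h1 : HasFDerivAt (fun ζ => coordL i (restr f ζ * q)) _ ζ :=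
    (coordL i).hasFDerivAt.comp ζ (hp.mul_const' q)
  refine (hasFDerivAt_of_restrictScalars ℝ (f' := ContinuousLinearMap.toSpanSingleton ℂ
    (coordL i (p * q))) h1 ?_).differentiableAt.differentiableWithinAt
  refine ContinuousLinearMap.ext fun h => ?_
  change h * coordL i (p * q) = coordL i (plane i h * p * q)
  rw [mul_assoc, coordL_plane_mul]

theorem restr_kernel (hα : -1 < α) (w : sliceDisc i) {ζ : ℂ} (hζ : ‖ζ‖ < 1) :
    restr (kernel hα w) ζ = plane i (complexKernel α ζ (coord i w)) :=
  restr_ofSlice _ _ _ hζ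

/-- The reproducing property of the slice Bergman kernel. -/
theorem scalarProduct_kernel (hα : -1 < α) (w : sliceDisc i) (f : BergmanSpace i α) :
    scalarProduct (kernel hα w) f = restr f (coord i w) := by
  refine eq_of_coordL_mul (i := i) fun q => ?_
  have hint := integrable_star_mul (kernel hα w) f
  have h1 : ∀ᵐ z ∂(areaMeasure α), coordL i (star (restr (kernel hα w) z) * restr f z * q) =
      conj (complexKernel α z (coord i w)) * coordL i (restr f z * q) := by
    filter_upwards [ae_areaMeasure_norm_lt α] with z hz
    rw [restr_kernel hα w hz, star_plane, mul_assoc, coordL_plane_mul]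
  rw [scalarProduct_eq, ← integral_mul_const_of_integrable hint,
    ← (coordL i).integral_comp_comm (hint.mul_const q), integral_congr_ae h1]
  exact integral_conj_complexKernel_mul hα (norm_coord_lt w) (differentiableOn_coordL_restr f q)
    (((coordL i).integrable_comp (hint.mul_const q)).congr h1)

/-! ### Normalized kernels and the pseudo-hyperbolic metric -/

theorem J_kernel (hα : -1 < α) (w : sliceDisc i) :
    J (kernel hα w) = MulOpposite.op (i : ℍ) • kernel hα w :=
  J_ofSlice _ _ _ fun _ => imaginaryUnit_mul_plane _

theorem scalarProduct_kernel_kernel (hα : -1 < α) (z w : sliceDisc i) :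
    scalarProduct (kernel hα z) (kernel hα w) =
      plane i (complexKernel α (coord i z) (coord i w)) := by
  rw [scalarProduct_kernel, restr_kernel hα w (norm_coord_lt z)]

theorem norm_complexKernel (α : ℝ) {z w : ℂ} :
    ‖complexKernel α z w‖ = (‖1 - z * conj w‖ ^ (2 + α))⁻¹ := by
  rw [complexKernel, norm_div, norm_one, Complex.norm_cpow_real, one_div]

theorem bergmanNorm_kernel_sq (hα : -1 < α) (w : sliceDisc i) :
    bergmanNorm (kernel hα w) ^ 2 = ((1 - ‖coord i w‖ ^ 2) ^ (2 + α))⁻¹ := by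
  have h := congrArg norm (scalarProduct_self (kernel hα w))
  rw [scalarProduct_kernel_kernel, norm_plane, norm_complexKernel, ← ofReal_one_sub_norm_sq,
    Complex.norm_real, Real.norm_of_nonneg (one_sub_norm_sq_pos (norm_coord_lt w)).le,
    Quaternion.norm_coe, Real.norm_of_nonneg (by positivity)] at h
  exact h.symm

theorem bergmanNorm_kernel_pos (hα : -1 < α) (w : sliceDisc i) : 0 < bergmanNorm (kernel hα w) := by
  have h := bergmanNorm_kernel_sq hα w
  have h1 := Real.rpow_pos_of_pos (one_sub_norm_sq_pos (norm_coord_lt w)) (2 + α)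
  refine lt_of_le_of_ne (bergmanNorm_nonneg _) fun h0 => ?_
  rw [← h0, zero_pow two_ne_zero] at h
  exact (inv_pos.2 h1).ne h

theorem bergmanNorm_normalizedKernel (hα : -1 < α) (w : sliceDisc i) :
    bergmanNorm (normalizedKernel hα w) = 1 := by
  have h := bergmanNorm_kernel_pos hα w
  rw [normalizedKernel, bergmanNorm_smul, MulOpposite.unop_op, Quaternion.norm_coe,
    Real.norm_of_nonneg (by positivity), mul_inv_cancel₀ h.ne']

theorem J_normalizedKernel (hα : -1 < α) (w : sliceDisc i) :
    J (normalizedKernel hα w) = MulOpposite.op (i : ℍ) • normalizedKernel hα w := by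
  rw [normalizedKernel, J_smul, J_kernel, smul_smul, smul_smul, ← MulOpposite.op_mul,
    ← MulOpposite.op_mul, Quaternion.coe_commutes]

theorem scalarProduct_normalizedKernel (hα : -1 < α) (z w : sliceDisc i) :
    scalarProduct (normalizedKernel hα z) (normalizedKernel hα w) =
      plane i (((bergmanNorm (kernel hα z))⁻¹ * (bergmanNorm (kernel hα w))⁻¹ : ℝ) *
        complexKernel α (coord i z) (coord i w)) := by
  have h : ∀ r : ℝ, plane i (r : ℂ) = (r : ℍ) := fun r => by simp
  rw [normalizedKernel, normalizedKernel, scalarProduct_smul_left, scalarProduct_smul_right,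
    scalarProduct_kernel_kernel, map_mul, h, MulOpposite.unop_op, MulOpposite.unop_op,
    Quaternion.star_coe, ← Quaternion.coe_commutes, ← mul_assoc, ← Quaternion.coe_mul]

theorem pseudoHyperbolic_eq (z w : sliceDisc i) :
    pseudoHyperbolic z w =
      ‖coord i w - coord i z‖ / ‖1 - coord i z * conj (coord i w)‖ := by
  have h1 : (z : ℍ) - w = plane i (coord i z - coord i w) := by
    rw [map_sub, plane_coord, plane_coord]
  have h2 : 1 - (z : ℍ) * star (w : ℍ) = plane i (1 - coord i z * conj (coord i w)) := by
    rw [map_sub, map_mul, map_one, ← star_plane, plane_coord, plane_coord]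
  rw [pseudoHyperbolic, h1, h2, norm_plane, norm_plane, norm_sub_rev]

/-- The left side is `|K_w(z)|² / (K_z(z) K_w(w))`, a power of the quotient that
`norm_kernel_base_sq` identifies with `1 - ρ²`. -/
theorem norm_scalarProduct_normalizedKernel_sq (hα : -1 < α) (z w : sliceDisc i) :
    ‖scalarProduct (normalizedKernel hα z) (normalizedKernel hα w)‖ ^ 2 =
      (1 - pseudoHyperbolic z w ^ 2) ^ (2 + α) := by
  have hz := one_sub_norm_sq_pos (norm_coord_lt z)
  have hw := one_sub_norm_sq_pos (norm_coord_lt w)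
  have hn := norm_pos_iff.2 (kernel_base_ne_zero (norm_coord_lt z) (norm_coord_lt w))
  have h1 : 1 - pseudoHyperbolic z w ^ 2 = (1 - ‖coord i w‖ ^ 2) * (1 - ‖coord i z‖ ^ 2) /
      ‖1 - coord i z * conj (coord i w)‖ ^ 2 := by
    rw [← norm_kernel_base_sq, pseudoHyperbolic_eq]
    field_simp
  have h2 : (‖1 - coord i z * conj (coord i w)‖ ^ (2 + α)) ^ 2 =
      (‖1 - coord i z * conj (coord i w)‖ ^ 2) ^ (2 + α) := by
    rw [← Real.rpow_two, ← Real.rpow_two, ← Real.rpow_mul hn.le, mul_comm (2 + α),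
      Real.rpow_mul hn.le]
  rw [h1, Real.div_rpow (by positivity) (by positivity), Real.mul_rpow hw.le hz.le,
    scalarProduct_normalizedKernel, norm_plane, norm_mul, norm_complexKernel, Complex.norm_real,
    norm_mul, norm_inv, norm_inv, Real.norm_of_nonneg (bergmanNorm_nonneg _),
    Real.norm_of_nonneg (bergmanNorm_nonneg _), mul_pow, mul_pow, inv_pow, inv_pow, inv_pow,
    bergmanNorm_kernel_sq, bergmanNorm_kernel_sq, inv_inv, inv_inv, h2]
  ring

/-! ### Differences of quadratic forms and the Lipschitz estimate -/

theorem exists_norm_one_mul_eq_norm (γ : ℂ) : ∃ c : ℂ, ‖c‖ = 1 ∧ γ * c = (‖γ‖ : ℂ) := by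
  rcases eq_or_ne γ 0 with rfl | h
  · exact ⟨1, by simp⟩
  · have h1 : (‖γ‖ : ℂ) ≠ 0 := Complex.ofReal_ne_zero.2 (norm_ne_zero_iff.2 h)
    refine ⟨conj γ / ‖γ‖, by simp [h], ?_⟩
    rw [mul_div_assoc', Complex.mul_conj', sq, mul_div_cancel_left₀ _ h1]

theorem bergmanNorm_eq_sqrt {f : BergmanSpace i α} {r : ℝ} (h : scalarProduct f f = (r : ℍ)) :
    bergmanNorm f = √r := by
  rw [scalarProduct_self, Quaternion.coe_inj] at h
  rw [← h, Real.sqrt_sq (bergmanNorm_nonneg f)]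

/-- Two unit vectors whose scalar product is real have quadratic forms that differ by at most
`2 ‖T‖ √(1 - ⟨a, b⟩²)`. -/
theorem norm_quadraticForm_sub_le_of_real {T : BergmanSpace i α →ₗ[ℍᵐᵒᵖ] BergmanSpace i α}
    (hT : ∃ C : ℝ, ∀ f, bergmanNorm (T f) ≤ C * bergmanNorm f) {a b : BergmanSpace i α}
    (ha : bergmanNorm a = 1) (hb : bergmanNorm b = 1) {r : ℝ}
    (hab : scalarProduct a b = (r : ℍ)) :
    ‖scalarProduct a (T a) - scalarProduct b (T b)‖ ≤ 2 * operatorNorm T * √(1 - r ^ 2) := by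
  have hba : scalarProduct b a = (r : ℍ) := by
    rw [← star_scalarProduct, hab, Quaternion.star_coe]
  have haa : scalarProduct a a = ((1 : ℝ) : ℍ) := by rw [scalarProduct_self, ha, one_pow]
  have hbb : scalarProduct b b = ((1 : ℝ) : ℍ) := by rw [scalarProduct_self, hb, one_pow]
  have hm : bergmanNorm (a - b) = √(2 - 2 * r) := bergmanNorm_eq_sqrt <| by
    rw [scalarProduct_sub_left, scalarProduct_sub_right, scalarProduct_sub_right, haa, hbb, hab,
      hba]
    simp only [← Quaternion.coe_sub]
    congr 1
    ring
  have hp : bergmanNorm (a + b) = √(2 + 2 * r) := bergmanNorm_eq_sqrt <| by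
    rw [scalarProduct_add_left, scalarProduct_add_right, scalarProduct_add_right, haa, hbb, hab,
      hba]
    simp only [← Quaternion.coe_add]
    congr 1
    ring
  have hr : |r| ≤ 1 := by
    have := norm_scalarProduct_le a b
    rwa [hab, ha, hb, Quaternion.norm_coe, mul_one] at this
  have hprod : bergmanNorm (a - b) * bergmanNorm (a + b) = 2 * √(1 - r ^ 2) := by
    have h4 : (2 - 2 * r) * (2 + 2 * r) = 2 ^ 2 * (1 - r ^ 2) := by ring
    rw [hm, hp, ← Real.sqrt_mul (by linarith [(abs_le.1 hr).2]), h4,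
      Real.sqrt_mul (by positivity), Real.sqrt_sq zero_le_two]
  -- Polarization: the terms `⟨a, Tb⟩` and `⟨b, Ta⟩` cancel in the sum.
  have hid : (2 : ℝ) • (scalarProduct a (T a) - scalarProduct b (T b)) =
      scalarProduct (a - b) (T (a + b)) + scalarProduct (a + b) (T (a - b)) := by
    rw [map_add, map_sub]
    simp only [scalarProduct_sub_left, scalarProduct_add_left, scalarProduct_sub_right,
      scalarProduct_add_right]
    module
  have h1 : ‖scalarProduct (a - b) (T (a + b))‖ ≤ operatorNorm T * (2 * √(1 - r ^ 2)) := by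
    refine (norm_scalarProduct_le _ _).trans ?_
    rw [← hprod, mul_left_comm]
    exact mul_le_mul_of_nonneg_left (bergmanNorm_le_operatorNorm_mul hT _) (bergmanNorm_nonneg _)
  have h2 : ‖scalarProduct (a + b) (T (a - b))‖ ≤ operatorNorm T * (2 * √(1 - r ^ 2)) := by
    refine (norm_scalarProduct_le _ _).trans ?_
    rw [← hprod, mul_comm (bergmanNorm (a - b)), mul_left_comm]
    exact mul_le_mul_of_nonneg_left (bergmanNorm_le_operatorNorm_mul hT _) (bergmanNorm_nonneg _)
  have h3 := (norm_add_le _ _).trans (add_le_add h1 h2)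
  rw [← hid, norm_smul, Real.norm_ofNat] at h3
  linarith

/-- Replacing `b` by `b c` with unimodular `c ∈ ℂ_i` makes the scalar product with `a` equal to
`‖γ‖` and turns `⟨b, Tb⟩` into `conj c ⟨b, Tb⟩ c`. As `TJ = JT` and `Jb = b i`, the number `⟨b, Tb⟩`
commutes with `i`, hence with `c`, and is unchanged. -/
theorem norm_quadraticForm_sub_le {T : BergmanSpace i α →ₗ[ℍᵐᵒᵖ] BergmanSpace i α}
    (hT : T ∈ commutantJ i α) {a b : BergmanSpace i α} (ha : bergmanNorm a = 1)
    (hb : bergmanNorm b = 1) (hJ : J b = MulOpposite.op (i : ℍ) • b) {γ : ℂ}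
    (hab : scalarProduct a b = plane i γ) :
    ‖scalarProduct a (T a) - scalarProduct b (T b)‖ ≤
      2 * operatorNorm T * √(1 - ‖γ‖ ^ 2) := by
  obtain ⟨c, hc, hγ⟩ := exists_norm_one_mul_eq_norm γ
  have h := scalarProduct_J hJ (T b)
  rw [← hT.2 b, hJ, map_smul, scalarProduct_smul_right, MulOpposite.unop_op] at h
  have h1 := norm_quadraticForm_sub_le_of_real hT.1 (b := MulOpposite.op (plane i c) • b) ha
    (by rw [bergmanNorm_smul, hb, MulOpposite.unop_op, norm_plane, hc, mul_one]) (r := ‖γ‖)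
    (by rw [scalarProduct_smul_right, hab, MulOpposite.unop_op, ← map_mul, hγ]; simp)
  have hcc : conj c * c = 1 := by rw [mul_comm, Complex.mul_conj', hc]; simp
  rwa [map_smul, scalarProduct_smul_left, scalarProduct_smul_right, MulOpposite.unop_op,
    ← mul_plane_comm h.symm, ← mul_assoc, star_plane, ← map_mul, hcc, map_one, one_mul] at h1

theorem pseudoHyperbolic_nonneg (z w : ℍ) : 0 ≤ pseudoHyperbolic z w :=
  div_nonneg (norm_nonneg _) (norm_nonneg _)

theorem pseudoHyperbolic_sq_le_one (z w : sliceDisc i) : pseudoHyperbolic z w ^ 2 ≤ 1 := by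
  have hz := one_sub_norm_sq_pos (norm_coord_lt z)
  have hw := one_sub_norm_sq_pos (norm_coord_lt w)
  have h := norm_kernel_base_sq (coord i z) (coord i w)
  rw [pseudoHyperbolic_eq, div_pow]
  refine div_le_one_of_le₀ ?_ (by positivity)
  nlinarith [mul_pos hw hz]

/-- The Lipschitz estimate for the Berezin transform. -/
theorem norm_berezin_sub_le (hα : -1 < α) {T : BergmanSpace i α →ₗ[ℍᵐᵒᵖ] BergmanSpace i α}
    (hT : T ∈ commutantJ i α) (z w : sliceDisc i) :
    ‖berezin hα T z - berezin hα T w‖ ≤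
      2 * √(2 + α) * operatorNorm T * pseudoHyperbolic z w := by
  have h0 := scalarProduct_normalizedKernel hα z w
  have h := norm_quadraticForm_sub_le hT (bergmanNorm_normalizedKernel hα z)
    (bergmanNorm_normalizedKernel hα w) (J_normalizedKernel hα w) h0
  rw [← norm_plane i, ← h0, norm_scalarProduct_normalizedKernel_sq] at h
  -- Bernoulli's inequality at `-ρ² ≥ -1` with exponent `2 + α ≥ 1`.
  have hB := one_add_mul_self_le_rpow_one_add (s := -pseudoHyperbolic z w ^ 2)
    (by linarith [pseudoHyperbolic_sq_le_one z w]) (p := 2 + α) (by linarith)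
  have h1 : √(1 - (1 - pseudoHyperbolic z w ^ 2) ^ (2 + α)) ≤
      √(2 + α) * pseudoHyperbolic z w := by
    rw [← Real.sqrt_sq (pseudoHyperbolic_nonneg (z : ℍ) w), ← Real.sqrt_mul (by linarith),
      Real.sqrt_sq (pseudoHyperbolic_nonneg (z : ℍ) w)]
    refine Real.sqrt_le_sqrt ?_
    rw [← sub_eq_add_neg] at hB
    linarith
  have h2 := mul_le_mul_of_nonneg_left h1 (mul_nonneg zero_le_two (operatorNorm_nonneg T))
  refine h.trans (h2.trans (le_of_eq (by ring)))

/-! ### Sharpness of the constant -/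

/-- The operator `f ↦ a ⟨a, f⟩ - b ⟨b, f⟩`, for unit vectors the difference of two orthogonal
projections of rank one. -/
def projDiff (a b : BergmanSpace i α) : BergmanSpace i α →ₗ[ℍᵐᵒᵖ] BergmanSpace i α where
  toFun f := MulOpposite.op (scalarProduct a f) • a - MulOpposite.op (scalarProduct b f) • b
  map_add' f g := by
    simp only [scalarProduct_add_right, MulOpposite.op_add, add_smul]
    abel
  map_smul' c f := by
    simp only [scalarProduct_smul_right, MulOpposite.op_mul, MulOpposite.op_unop, smul_sub,
      mul_smul, RingHom.id_apply]

theorem projDiff_apply (a b f : BergmanSpace i α) : projDiff a b f =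
    MulOpposite.op (scalarProduct a f) • a - MulOpposite.op (scalarProduct b f) • b := rfl

/-- Both orders give `a (i ⟨a, f⟩) - b (i ⟨b, f⟩)`: `J` moves `a` to `a i`, and `⟨a, J f⟩ = i ⟨a,
f⟩`. -/
theorem projDiff_J {a b : BergmanSpace i α} (ha : J a = MulOpposite.op (i : ℍ) • a)
    (hb : J b = MulOpposite.op (i : ℍ) • b) (f : BergmanSpace i α) :
    projDiff a b (J f) = J (projDiff a b f) := by
  rw [projDiff_apply, projDiff_apply, J_sub, J_smul, J_smul, ha, hb, scalarProduct_J ha,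
    scalarProduct_J hb, MulOpposite.op_mul, MulOpposite.op_mul, mul_smul, mul_smul]

theorem scalarProduct_self_of_norm_eq_one {f : BergmanSpace i α} (hf : bergmanNorm f = 1) :
    scalarProduct f f = 1 := by
  rw [scalarProduct_self, hf, one_pow, Quaternion.coe_one]

theorem scalarProduct_comm_of_real {f g : BergmanSpace i α} {r : ℝ}
    (h : scalarProduct f g = (r : ℍ)) :
    scalarProduct g f = (r : ℍ) := by
  rw [← star_scalarProduct, h, Quaternion.star_coe]

theorem scalarProduct_self_re (f : BergmanSpace i α) :
    (scalarProduct f f).re = bergmanNorm f ^ 2 := by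
  rw [scalarProduct_self, Quaternion.re_coe]

theorem bergmanNorm_projDiff_sq {a b : BergmanSpace i α} (ha : bergmanNorm a = 1)
    (hb : bergmanNorm b = 1) {r : ℝ} (hab : scalarProduct a b = (r : ℍ)) (f : BergmanSpace i α) :
    bergmanNorm (projDiff a b f) ^ 2 =
      (star (scalarProduct a f) * scalarProduct a f).re +
        (star (scalarProduct b f) * scalarProduct b f).re -
        2 * r * (star (scalarProduct a f) * scalarProduct b f).re := by
  rw [← scalarProduct_self_re, projDiff_apply]
  simp only [scalarProduct_sub_left, scalarProduct_sub_right, scalarProduct_smul_left,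
    scalarProduct_smul_right, MulOpposite.unop_op, scalarProduct_self_of_norm_eq_one ha,
    scalarProduct_self_of_norm_eq_one hb, hab, scalarProduct_comm_of_real hab]
  generalize scalarProduct a f = x
  generalize scalarProduct b f = y
  simp
  ring

/-- On the span of `a` and `b` the operator is `√(1 - r²)` times an isometry, and it vanishes on the
orthogonal complement. The bound is then Bessel's inequality for the projection to the span. -/
theorem bergmanNorm_projDiff_le {a b : BergmanSpace i α} (ha : bergmanNorm a = 1)
    (hb : bergmanNorm b = 1) {r : ℝ} (hab : scalarProduct a b = (r : ℍ)) (hr : r ^ 2 < 1)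
    (f : BergmanSpace i α) :
    bergmanNorm (projDiff a b f) ≤ √(1 - r ^ 2) * bergmanNorm f := by
  set s : ℝ := 1 - r ^ 2 with hs
  have hs0 : 0 < s := by linarith
  have h1 := bergmanNorm_projDiff_sq ha hb hab f
  set Q : ℝ := bergmanNorm (projDiff a b f) ^ 2
  -- The vector is `s (f - P f)` with `P` the orthogonal projection to the span of `a` and `b`. The
  -- coefficients come from the inverse Gram matrix `s⁻¹ [[1, -r], [-r, 1]]`; the factor `s` clears
  -- the denominator.
  have h2 : bergmanNorm (MulOpposite.op (s : ℍ) • f -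
      (MulOpposite.op (scalarProduct a f - r * scalarProduct b f) • a +
        MulOpposite.op (scalarProduct b f - r * scalarProduct a f) • b)) ^ 2 =
      s * (s * bergmanNorm f ^ 2 - Q) := by
    rw [← scalarProduct_self_re, h1, ← scalarProduct_self_re f]
    simp only [scalarProduct_sub_left, scalarProduct_sub_right, scalarProduct_add_left,
      scalarProduct_add_right, scalarProduct_smul_left,
      scalarProduct_smul_right, MulOpposite.unop_op, scalarProduct_self_of_norm_eq_one ha,
      scalarProduct_self_of_norm_eq_one hb, hab, scalarProduct_comm_of_real hab]
    rw [← star_scalarProduct a f, ← star_scalarProduct b f]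
    generalize scalarProduct a f = x
    generalize scalarProduct b f = y
    generalize scalarProduct f f = n
    simp
    rw [hs]
    ring
  have h3 : 0 ≤ s * bergmanNorm f ^ 2 - Q :=
    nonneg_of_mul_nonneg_right (h2 ▸ sq_nonneg _) hs0
  refine (sq_le_sq₀ (bergmanNorm_nonneg _)
    (mul_nonneg (Real.sqrt_nonneg _) (bergmanNorm_nonneg _))).1 ?_
  rw [mul_pow, Real.sq_sqrt hs0.le]
  linarith

theorem operatorNorm_projDiff_le {a b : BergmanSpace i α} (ha : bergmanNorm a = 1)
    (hb : bergmanNorm b = 1) {r : ℝ} (hab : scalarProduct a b = (r : ℍ)) (hr : r ^ 2 < 1) :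
    operatorNorm (projDiff a b) ≤ √(1 - r ^ 2) := by
  refine Real.sSup_le ?_ (Real.sqrt_nonneg _)
  rintro _ ⟨f, hf, rfl⟩
  have := bergmanNorm_projDiff_le ha hb hab hr f
  rwa [hf, mul_one] at this

theorem quadraticForm_projDiff_sub {a b : BergmanSpace i α} (ha : bergmanNorm a = 1)
    (hb : bergmanNorm b = 1) {r : ℝ} (hab : scalarProduct a b = (r : ℍ)) :
    scalarProduct a (projDiff a b a) - scalarProduct b (projDiff a b b) =
      ((2 * (1 - r ^ 2) : ℝ) : ℍ) := by
  simp only [projDiff_apply, scalarProduct_sub_right, scalarProduct_smul_right,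
    MulOpposite.unop_op, scalarProduct_self_of_norm_eq_one ha,
    scalarProduct_self_of_norm_eq_one hb, hab, scalarProduct_comm_of_real hab]
  rw [← Quaternion.coe_one]
  simp only [← Quaternion.coe_mul, ← Quaternion.coe_sub]
  congr 1
  ring

/-- The point `t` of the real diameter of the disc `𝔻_i`. -/
def realPoint (i : ImaginaryUnit) (t : ℝ) (ht : |t| < 1) : sliceDisc i :=
  ⟨plane i t, (plane_mem_ball i _).2 (by simpa using ht), t, rfl⟩

theorem lipschitz_constant_at_radius (hα : -1 < α) {C : ℝ}
    (hC : ∀ T ∈ commutantJ i α, ∀ z w : sliceDisc i,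
      ‖berezin hα T z - berezin hα T w‖ ≤ C * operatorNorm T * pseudoHyperbolic z w)
    {t : ℝ} (h0 : 0 < t) (h1 : t < 1) :
    0 ≤ C ∧ 4 * (1 - (1 - t ^ 2) ^ (2 + α)) ≤ C ^ 2 * t ^ 2 := by
  set z := realPoint i 0 (by simp)
  set w := realPoint i t (by rwa [abs_of_pos h0])
  have cz : coord i z = 0 := (coord_plane _).trans Complex.ofReal_zero
  have cw : coord i w = t := coord_plane _
  have hρ : pseudoHyperbolic z w = t := by
    rw [pseudoHyperbolic_eq, cz, cw]
    simp [h0.le]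
  have ha := bergmanNorm_normalizedKernel hα z
  have hb := bergmanNorm_normalizedKernel hα w
  obtain ⟨r, hab⟩ : ∃ r : ℝ, scalarProduct (normalizedKernel hα z) (normalizedKernel hα w) =
      (r : ℍ) := by
    rw [scalarProduct_normalizedKernel, cz, complexKernel_zero_left, mul_one]
    exact ⟨_, (plane_apply i _).trans (by
      rw [Complex.ofReal_re, Complex.ofReal_im, zero_smul, add_zero])⟩
  have hr : r ^ 2 = (1 - t ^ 2) ^ (2 + α) := by
    have := norm_scalarProduct_normalizedKernel_sq hα z w
    rwa [hab, hρ, Quaternion.norm_coe, Real.norm_eq_abs, sq_abs] at this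
  have hr1 : r ^ 2 < 1 := by
    rw [hr]
    exact Real.rpow_lt_one (by nlinarith) (by nlinarith) (by linarith)
  have hT : projDiff (normalizedKernel hα z) (normalizedKernel hα w) ∈ commutantJ i α :=
    ⟨⟨_, bergmanNorm_projDiff_le ha hb hab hr1⟩,
      projDiff_J (J_normalizedKernel hα z) (J_normalizedKernel hα w)⟩
  have h := hC _ hT z w
  rw [berezin, berezin, quadraticForm_projDiff_sub ha hb hab, hρ, Quaternion.norm_coe,
    Real.norm_of_nonneg (by linarith)] at h
  have hn := operatorNorm_nonneg (projDiff (normalizedKernel hα z) (normalizedKernel hα w))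
  have hle := operatorNorm_projDiff_le ha hb hab hr1
  -- A negative `C` would make the right side of `h` nonpositive, while its left side `2(1 - r²)` is
  -- positive. With `C ≥ 0`, an upper bound for the operator norm suffices below.
  have hC0 : 0 ≤ C := by
    by_contra hneg
    have := mul_nonneg (mul_nonneg (neg_nonneg.2 (not_le.1 hneg).le) hn) h0.le
    nlinarith
  refine ⟨hC0, ?_⟩
  rw [← hr]
  have hs : 0 < √(1 - r ^ 2) := Real.sqrt_pos.2 (by linarith)
  have hss : √(1 - r ^ 2) ^ 2 = 1 - r ^ 2 := Real.sq_sqrt (by linarith)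
  have h2 : 2 * √(1 - r ^ 2) ≤ C * t := by
    refine le_of_mul_le_mul_right ?_ hs
    calc 2 * √(1 - r ^ 2) * √(1 - r ^ 2) = 2 * (1 - r ^ 2) := by rw [mul_assoc, ← sq, hss]
      _ ≤ C * operatorNorm _ * t := h
      _ ≤ C * √(1 - r ^ 2) * t := by gcongr
      _ = C * t * √(1 - r ^ 2) := by ring
  have h3 := pow_le_pow_left₀ (by positivity) h2 2
  rw [mul_pow, mul_pow, hss] at h3
  linarith

/-- Bernoulli bounds the product by `((1 - x)(1 + x))^p ≤ 1`. It serves as the lower bound `1 - (1 -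
x)^p ≥ p x / (1 + p x)`, of first order `p x` at `0`. -/
theorem one_sub_rpow_le {x p : ℝ} (h0 : 0 < x) (h1 : x < 1) (hp : 1 ≤ p) :
    (1 - x) ^ p * (1 + p * x) ≤ 1 := by
  have h2 := one_add_mul_self_le_rpow_one_add (s := x) (by linarith) hp
  have h3 : 0 ≤ (1 - x) ^ p := Real.rpow_nonneg (by linarith) _
  refine (mul_le_mul_of_nonneg_left h2 h3).trans ?_
  rw [← Real.mul_rpow (by linarith) (by linarith)]
  exact Real.rpow_le_one (by nlinarith) (by nlinarith) (by linarith)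

theorem le_of_forall_one_sub_rpow_le {p D : ℝ} (hp : 1 ≤ p)
    (h : ∀ x : ℝ, 0 < x → x < 1 → 4 * (1 - (1 - x) ^ p) ≤ D * x) : 4 * p ≤ D := by
  have key : ∀ x : ℝ, 0 < x → x < 1 → 4 * p ≤ D * (1 + p * x) := by
    intro x h0 h1
    have h2 := one_sub_rpow_le h0 h1 hp
    have h3 := mul_le_mul_of_nonneg_right (h x h0 h1) (by positivity : 0 ≤ 1 + p * x)
    refine le_of_mul_le_mul_right ?_ h0
    nlinarith
  have ht : Filter.Tendsto (fun x : ℝ => D * (1 + p * x)) (nhdsWithin 0 (Set.Ioi 0))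
      (nhds (D * (1 + p * 0))) :=
    (Continuous.tendsto (by fun_prop) 0).mono_left nhdsWithin_le_nhds
  rw [mul_zero, add_zero, mul_one] at ht
  refine ge_of_tendsto ht ?_
  filter_upwards [Ioo_mem_nhdsGT (zero_lt_one' ℝ)] with x hx
  exact key x hx.1 hx.2

/-- The Lipschitz constant `2 √(2 + α)` cannot be improved. -/
theorem le_lipschitz_constant (hα : -1 < α) {C : ℝ}
    (hC : ∀ T ∈ commutantJ i α, ∀ z w : sliceDisc i,
      ‖berezin hα T z - berezin hα T w‖ ≤ C * operatorNorm T * pseudoHyperbolic z w) :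
    2 * √(2 + α) ≤ C := by
  have hC0 : 0 ≤ C := (lipschitz_constant_at_radius hα hC one_half_pos one_half_lt_one).1
  have h4 : 4 * (2 + α) ≤ C ^ 2 := by
    refine le_of_forall_one_sub_rpow_le (by linarith) fun x h0 h1 => ?_
    -- The radius `t = √x` turns the bound in `t²` into one linear in `x`.
    have h := (lipschitz_constant_at_radius hα hC (Real.sqrt_pos.2 h0)
      ((Real.sqrt_lt' one_pos).2 (by rwa [one_pow]))).2
    rwa [Real.sq_sqrt h0.le] at h
  refine (sq_le_sq₀ (by positivity) hC0).1 ?_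
  rw [mul_pow, Real.sq_sqrt (by linarith)]
  linarith

end SliceBergman

end

theorem mainTheorem6 (i : SliceBergman.ImaginaryUnit) (α : ℝ) (hα : -1 < α) :
    (∀ (w : SliceBergman.sliceDisc i) (f : SliceBergman.BergmanSpace i α),
      SliceBergman.scalarProduct (SliceBergman.kernel hα w) f = f.1 ⟨w, w.2.1⟩) ∧
    (∀ T ∈ SliceBergman.commutantJ i α, ∀ z w : SliceBergman.sliceDisc i,
      ‖SliceBergman.berezin hα T z - SliceBergman.berezin hα T w‖ ≤
        2 * Real.sqrt (2 + α) * SliceBergman.operatorNorm T *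
          SliceBergman.pseudoHyperbolic z w) ∧
    (∀ C : ℝ,
      (∀ T ∈ SliceBergman.commutantJ i α, ∀ z w : SliceBergman.sliceDisc i,
        ‖SliceBergman.berezin hα T z - SliceBergman.berezin hα T w‖ ≤
          C * SliceBergman.operatorNorm T * SliceBergman.pseudoHyperbolic z w) →
      2 * Real.sqrt (2 + α) ≤ C) := by
  refine ⟨fun w f => ?_, fun T hT z w => SliceBergman.norm_berezin_sub_le hα hT z w,
    fun C hC => SliceBergman.le_lipschitz_constant hα hC⟩
  rw [SliceBergman.scalarProduct_kernel, SliceBergman.restr, SliceBergman.plane_coord,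
    SliceBergman.extendZero_of_mem _ w.2.1]
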